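/- For integers $m\ge 2$ and $n\ge 1$, put $\zeta_m=e^{2\pi\sqrt{-1}/m}$. A function $f:\mathbb{Z}_2^n\to\mathbb{Z}_m$ is called an $(m,n)$-generalized bent function if $$\Bigl|\sum_{x\in\mathbb{Z}_2^n}\zeta_m^{f(x)}(-1)^{y\cdot x}\Bigr|^2=2^n\qquad\text{for all } y\in\mathbb{Z}_2^n,$$ where $y\cdot x$ is the usual inner product on $\mathbb{Z}_2^n$. **Theorem.** Let $m\ge 2$ be an integer that is odd or satisfies $m\equiv 2\pmod 4$. Then there is no $(m,3)$-generalized bent function. -/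

import Mathlib

/-- The standard primitive complex `m`-th root of unity `ζ_m = exp (2 π i / m)` (for `m ≥ 1`). -/
noncomputable def zetaRoot (m : ℕ) : ℂ :=
  Complex.exp (2 * (Real.pi : ℂ) * Complex.I / (m : ℂ))

/-- The transform `F(y) = ∑ x, ζ_m ^ f(x) * (-1) ^ (y · x)` over `x ∈ ℤ₂ⁿ`,
for `f : ℤ₂ⁿ → ℤ_m` (with `m ≥ 1`), where `y · x = ∑ i, y i * x i` in `ℤ₂`. -/
noncomputable def gbfTransform (m n : ℕ) (f : (Fin n → ZMod 2) → ZMod m)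
    (y : Fin n → ZMod 2) : ℂ :=
  ∑ x : Fin n → ZMod 2, zetaRoot m ^ (f x).val * (-1 : ℂ) ^ (∑ i, y i * x i : ZMod 2).val

/-- `f : ℤ₂ⁿ → ℤ_m` is an `(m,n)`-generalized bent function: `|F(y)|² = 2ⁿ` for all `y`. -/
def IsGeneralizedBent (m n : ℕ) (f : (Fin n → ZMod 2) → ZMod m) : Prop :=
  ∀ y : Fin n → ZMod 2, ‖gbfTransform m n f y‖ ^ 2 = (2 : ℝ) ^ n

/-! Since |F|² is constant, inverting its transform shows that the autocorrelation of ζ^f vanishes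
in every nonzero direction u. As m is odd or twice an odd number, each value ζ^f(x) equals
ε(x)ψ(k(x)), with ε(x) = ±1 and ψ a faithful character of ℤ_q × ℤ_M, where q is a power of 3 and M
is prime to 6. Each direction thus gives a vanishing sum of eight signed roots of unity of odd
order.

Arithmetic. Galois conjugation makes the partial sums over the p-part of the order constant on
cosets of the p-torsion (`fiber_sum_add_torsion`). For orders prime to 6 this leaves, up to norm
eight, only rotated full sets of fifth or seventh roots (`shortSums_zmod`). At the prime 3 the
autocorrelation has extra structure: exchanging x and x + u makes its coefficients symmetric, the
coefficient at 0 is even, and the total is divisible by 4. Besides complete cancellation, three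
shapes survive (`vanishing_symm_classification`), built from fifth or seventh roots together with
cube roots.

Combinatorics. Let f and g be the components of k. Every direction is cancelling, of constant sign,
or has its sign determined by whether f separates x from x + u. The sign function ε then has
derivative of weight 4, of weight 0 or 8, or of weight 2 or 6, respectively. The derivative weights
of a Boolean function on the 3-cube are all 0 or all 2 modulo 4, so the third kind never coexists
with the other two. The remaining configurations are all contradictory (`no_cube_configuration`). -/

open Finset

/-! ### Galois conjugation and fibre sums -/

/-- A rational linear relation between roots of unity is preserved by Galois conjugation. -/
theorem sum_mul_pow_eq_zero_of_coprime {G : Type*} [Fintype G] {N : ℕ} (hN : N ≠ 0)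
    (z : G → ℂ) (hz : ∀ k, z k ^ N = 1) (c : G → ℤ) (h : ∑ k, (c k : ℂ) * z k = 0)
    {t : ℕ} (ht : t.Coprime N) : ∑ k, (c k : ℂ) * z k ^ t = 0 := by
  have : NeZero N := ⟨hN⟩
  have hζ := Complex.isPrimitiveRoot_exp N hN
  set ζ := Complex.exp (2 * Real.pi * Complex.I / N)
  have he : ∀ k, ∃ e : ℕ, ζ ^ e = z k := fun k => by
    obtain ⟨i, -, hi⟩ := hζ.eq_pow_of_pow_eq_one (hz k)
    exact ⟨i, hi⟩
  choose e he using he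
  let f : Polynomial ℤ := ∑ k, Polynomial.C (c k) * Polynomial.X ^ e k
  have hf : Polynomial.aeval ζ f = 0 := by
    simpa [f, he] using h
  have hdvd : minpoly ℤ ζ ∣ f :=
    minpoly.isIntegrallyClosed_dvd (hζ.isIntegral (Nat.pos_of_ne_zero hN)) hf
  rw [hζ.minpoly_eq_pow_coprime ht] at hdvd
  obtain ⟨g, hg⟩ := hdvd
  have h2 : Polynomial.aeval (ζ ^ t) f = 0 := by rw [hg]; simp
  simpa [f, ← he, ← pow_mul, mul_comm t] using h2

/-- The fibre sums of a vanishing sum of roots of unity over the `p`-part are constant on cosets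
of the `p`-torsion. -/
theorem fiber_sum_add_torsion {p a q : ℕ} [hp : Fact p.Prime]
    (hq : q = p ^ (a + 1)) {H : Type*} [AddCommGroup H] [Fintype H]
    (hH : p.Coprime (Fintype.card H)) [NeZero q] (ψ : AddChar (ZMod q × H) ℂ)
    (hψ : Function.Injective ψ) (c : ZMod q × H → ℤ)
    (h : ∑ k, (c k : ℂ) * ψ k = 0) {d : ZMod q} (hd : p • d = 0)
    (r : ZMod q) :
    ∑ h, (c (r + d, h) : ℂ) * ψ (0, h) = ∑ h, (c (r, h) : ℂ) * ψ (0, h) := by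
  let χ : AddChar (ZMod q) ℂ := ψ.compAddMonoidHom (AddMonoidHom.inl (ZMod q) H)
  have hχ : ∀ x, χ x = ψ (x, 0) := fun x => rfl
  have hprim : χ.IsPrimitive := by
    intro b hb h1
    have := DFunLike.congr_fun h1 1
    rw [AddChar.mulShift_apply, mul_one, hχ, AddChar.one_apply, ← AddChar.map_zero_eq_one ψ] at this
    simpa [hb] using hψ this
  have hmul : ∀ x y, ψ (x, y) = χ x * ψ (0, y) := fun x y => by
    rw [hχ, ← AddChar.map_add_eq_mul]; simp
  set S : ZMod q → ℂ := fun r => ∑ h, (c (r, h) : ℂ) * ψ (0, h) with hS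
  set F : ZMod q → ℂ := fun s => ∑ r, S r * χ (r * s) with hF
  have hinv : ∀ r, (q : ℂ) * S r = ∑ s, χ (-(s * r)) * F s := by
    intro r
    calc (q : ℂ) * S r = ∑ r', S r' * ∑ s, χ (s * (r' - r)) := by
          simp_rw [AddChar.sum_mulShift _ hprim, sub_eq_zero]
          simp [mul_comm]
      _ = ∑ s, χ (-(s * r)) * F s := by
          simp_rw [hF, mul_sum]
          rw [sum_comm]
          refine sum_congr rfl fun s _ => sum_congr rfl fun r' _ => ?_
          rw [mul_left_comm, ← AddChar.map_add_eq_mul]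
          ring_nf
  -- The transform of the fibre sums is supported on multiples of p, and there the twist by
  -- p-torsion is trivial.
  have hkey : ∀ s, χ (-(s * d)) * F s = F s := by
    intro s
    by_cases hs : p ∣ s.val
    · obtain ⟨j, hj⟩ := hs
      have : s * d = 0 := by
        rw [← ZMod.natCast_zmod_val s, hj, Nat.cast_mul, mul_right_comm, ← nsmul_eq_mul, hd, zero_mul]
      simp [this]
    · have hcop : s.val.Coprime q :=
        hq ▸ ((Nat.Prime.coprime_iff_not_dvd hp.out).2 hs).symm.pow_right (a + 1)
      have hqH : q.Coprime (Fintype.card H) := hq ▸ hH.pow_left (a + 1)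
      -- For s prime to p, raising roots to the power t acts as s on the p-part and fixes the
      -- H-part, so F s is a Galois conjugate of the given vanishing sum.
      obtain ⟨t, ht1, ht2⟩ := Nat.chineseRemainder hqH s.val 1
      have htc : t.Coprime (q * Fintype.card H) := by
        refine Nat.Coprime.mul_right ?_ ?_
        · rw [Nat.Coprime, ht1.gcd_eq]; exact hcop
        · rw [Nat.Coprime, ht2.gcd_eq]; simp
      have hpow : ∀ k, ψ k ^ (q * Fintype.card H) = 1 := by
        intro k
        rw [← AddChar.map_nsmul_eq_pow]
        have : (q * Fintype.card H) • k = 0 := by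
          have := card_nsmul_eq_zero' (x := k)
          rwa [Nat.card_prod, Nat.card_zmod, Nat.card_eq_fintype_card] at this
        rw [this, AddChar.map_zero_eq_one]
      have h0 := sum_mul_pow_eq_zero_of_coprime
        (mul_ne_zero (NeZero.ne q) Fintype.card_ne_zero) ψ hpow c h htc
      have : F s = 0 := by
        rw [← h0, hF, Fintype.sum_prod_type]
        simp_rw [hS, sum_mul]
        refine sum_congr rfl fun x _ => sum_congr rfl fun y _ => ?_
        rw [← AddChar.map_nsmul_eq_pow, mul_assoc, Prod.smul_mk, hmul (t • x)]
        congr 1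
        rw [mul_comm]
        congr 2
        · rw [nsmul_eq_mul, mul_comm, (ZMod.natCast_eq_natCast_iff t s.val q).2 ht1,
            ZMod.natCast_zmod_val]
        · have h3 := (nsmul_eq_nsmul_iff_modEq (x := y) (n := t) (m := 1)).2
            (ht2.of_dvd (addOrderOf_dvd_card))
          rw [h3, one_nsmul]
      simp [this]
  have hq0 : (q : ℂ) ≠ 0 := by exact_mod_cast NeZero.ne q
  apply mul_left_cancel₀ hq0
  change (q : ℂ) * S (r + d) = q * S r
  rw [hinv, hinv]
  refine sum_congr rfl fun s _ => ?_
  conv_rhs => rw [← hkey s]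
  rw [mul_add, neg_add, AddChar.map_add_eq_mul, mul_assoc]

/-! ### Short vanishing sums of order prime to 6 -/

/-- `c` is, up to sign, the indicator function of a coset of the `p`-torsion, which has `p`
elements. -/
def IsTorsionCoset {H : Type*} [AddCommGroup H] [Fintype H] (p : ℕ) (c : H → ℤ) : Prop :=
  (∃ w θ, (θ = 1 ∨ θ = -1) ∧ (∀ k, p • (k - w) = 0 → c k = θ) ∧ ∀ k, p • (k - w) ≠ 0 → c k = 0) ∧
    ∑ k, |c k| = p

/-- A vanishing sum of at most eight signed roots of unity indexed by `H` is trivial, or a sum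
over a rotated group of 5th or 7th roots of unity. -/
def ShortSums (H : Type*) [AddCommGroup H] [Fintype H] : Prop :=
  ∀ ψ : AddChar H ℂ, Function.Injective ψ → ∀ c : H → ℤ, ∑ k, |c k| ≤ 8 →
    ∑ k, (c k : ℂ) * ψ k = 0 → c = 0 ∨ IsTorsionCoset 5 c ∨ IsTorsionCoset 7 c

theorem sum_abs_eq_zero {H : Type*} [Fintype H] {c : H → ℤ} (h : ∑ k, |c k| ≤ 0) : c = 0 := by
  have h0 : ∑ k, |c k| = 0 := le_antisymm h (sum_nonneg fun _ _ => abs_nonneg _)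
  funext k
  simpa using (sum_eq_zero_iff_of_nonneg fun _ _ => abs_nonneg _).1 h0 k (mem_univ k)

theorem exists_of_sum_abs_eq_one {H : Type*} [Fintype H] {c : H → ℤ}
    (h : ∑ k, |c k| = 1) : ∃ w θ, (θ = 1 ∨ θ = -1) ∧ c w = θ ∧ ∀ k, k ≠ w → c k = 0 := by
  classical
  obtain ⟨w, hw⟩ : ∃ w, c w ≠ 0 := by
    by_contra! h0
    simp [h0] at h
  have h1 := add_sum_erase univ (fun k => |c k|) (mem_univ w)
  have h2 : 0 ≤ ∑ k ∈ univ.erase w, |c k| := sum_nonneg fun _ _ => abs_nonneg _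
  have h3 : 1 ≤ |c w| := Int.one_le_abs hw
  have h4 : |c w| = 1 := by omega
  have h5 : ∑ k ∈ univ.erase w, |c k| = 0 := by omega
  refine ⟨w, c w, (abs_eq zero_le_one).1 h4, rfl, fun k hk => ?_⟩
  simpa using (sum_eq_zero_iff_of_nonneg fun _ _ => abs_nonneg _).1 h5 k (by simp [hk])

theorem eq_zero_of_coprime_nsmul {H : Type*} [AddCommGroup H] [Fintype H] {p : ℕ}
    (hp : p.Coprime (Fintype.card H)) {x : H} (hx : p • x = 0) : x = 0 := by
  rw [← AddMonoid.addOrderOf_eq_one_iff]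
  have h1 := addOrderOf_dvd_of_nsmul_eq_zero hx
  have h2 := addOrderOf_dvd_card (x := x)
  exact Nat.eq_one_of_dvd_coprimes hp h1 h2

theorem IsTorsionCoset.not_coprime {H : Type*} [AddCommGroup H] [Fintype H] {p : ℕ} {c : H → ℤ}
    (h : IsTorsionCoset p c) (hp1 : p ≠ 1) (hp : p.Coprime (Fintype.card H)) : False := by
  obtain ⟨⟨w, θ, hθ, h1, h2⟩, h3⟩ := h
  have : ∑ k, |c k| = |c w| := by
    refine Fintype.sum_eq_single w fun k hk => ?_
    rw [h2 k fun h0 => hk (sub_eq_zero.1 (eq_zero_of_coprime_nsmul hp h0)), abs_zero]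
  rw [h1 w (by simp)] at this
  rcases hθ with rfl | rfl <;> simp at this <;> omega

theorem ShortSums.eq_zero {H : Type*} [AddCommGroup H] [Fintype H] (hH : ShortSums H)
    (ψ : AddChar H ℂ) (hψ : Function.Injective ψ) {c : H → ℤ} (hc : ∑ k, |c k| ≤ 4)
    (h : ∑ k, (c k : ℂ) * ψ k = 0) : c = 0 := by
  rcases hH ψ hψ c (by omega) h with h | h | h
  · exact h
  · have := h.2; push_cast at this; omega
  · have := h.2; push_cast at this; omega

theorem ShortSums.of_addEquiv {H H' : Type*} [AddCommGroup H] [Fintype H] [AddCommGroup H']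
    [Fintype H'] (e : H ≃+ H') (hH : ShortSums H) : ShortSums H' := by
  intro ψ hψ c hc h
  have key : ∀ p, IsTorsionCoset p (fun k => c (e k)) → IsTorsionCoset p c := by
    rintro p ⟨⟨w, θ, hθ, h1, h2⟩, h3⟩
    refine ⟨⟨e w, θ, hθ, fun k hk => ?_, fun k hk => ?_⟩, ?_⟩
    · have := h1 (e.symm k) (by apply e.injective; simpa using hk)
      simpa using this
    · have := h2 (e.symm k) (fun h0 => hk (by simpa using congrArg e h0))
      simpa using this
    · rw [← h3]; exact (Equiv.sum_comp e.toEquiv fun k => |c k|).symm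
  rcases hH (ψ.compAddMonoidHom e.toAddMonoidHom) (hψ.comp e.injective) (fun k => c (e k))
    (by rw [← Equiv.sum_comp e.toEquiv] at hc; exact hc)
    (by rw [← Equiv.sum_comp e.toEquiv] at h; exact h) with h | h | h
  · left; funext k; simpa using congrFun h (e.symm k)
  · exact .inr (.inl (key _ h))
  · exact .inr (.inr (key _ h))

theorem ZMod.card_filter_nsmul_eq_zero {p a q : ℕ} [NeZero q] (hq : q = p ^ (a + 1)) :
    #{d : ZMod q | p • d = 0} = p := by
  have h := IsAddCyclic.card_nsmulAddMonoidHom_ker (ZMod q) p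
  rw [Nat.card_zmod] at h
  have h2 : q.gcd p = p := Nat.gcd_eq_right (hq ▸ dvd_pow_self p (Nat.succ_ne_zero a))
  rw [h2] at h
  rw [← Fintype.card_subtype, ← Nat.card_eq_fintype_card]
  exact h

/-- The restriction of a function on a product to a fibre inherits the coset shape. -/
theorem IsTorsionCoset.of_fiber {Q H : Type*} [AddCommGroup Q] [Fintype Q] [AddCommGroup H]
    [Fintype H] {p : ℕ} (hp : p.Coprime (Fintype.card Q)) {c : Q × H → ℤ} (r : Q)
    (h0 : ∀ r', r' ≠ r → ∀ h, c (r', h) = 0) (h : IsTorsionCoset p fun h => c (r, h)) :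
    IsTorsionCoset p c := by
  obtain ⟨⟨w, θ, hθ, h1, h2⟩, h3⟩ := h
  refine ⟨⟨(r, w), θ, hθ, ?_, ?_⟩, ?_⟩
  · rintro ⟨x, y⟩ hk
    rw [Prod.mk_sub_mk, Prod.smul_mk, Prod.mk_eq_zero] at hk
    obtain rfl := sub_eq_zero.1 (eq_zero_of_coprime_nsmul hp hk.1)
    exact h1 y hk.2
  · rintro ⟨x, y⟩ hk
    by_cases hx : x = r
    · subst hx
      exact h2 y fun h => hk (by simp [h])
    · exact h0 x hx y
  · rw [Fintype.sum_prod_type, ← h3]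
    exact Fintype.sum_eq_single r fun r' hr' => by simp [h0 r' hr']

/-- If all fibre sums vanish, a nonzero fibre has norm at least 5, leaving at most 3 for any other
fibre, too little for a nontrivial relation. If some fibre sum is nonzero, the p fibres over its
torsion coset share that sum. The bound 8 forces each of them to be the same single signed root and
leaves nothing elsewhere. -/
theorem ShortSums.prod {p a q : ℕ} [Fact p.Prime] [NeZero q] (hp5 : 5 ≤ p)
    (hq : q = p ^ (a + 1)) {H : Type*} [AddCommGroup H] [Fintype H]
    (hpH : p.Coprime (Fintype.card H)) (hH : ShortSums H) : ShortSums (ZMod q × H) := by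
  intro ψ hψ c hc hv
  have hpp : p.Prime := Fact.out
  let φ : AddChar H ℂ := ψ.compAddMonoidHom (AddMonoidHom.inr (ZMod q) H)
  have hφ : Function.Injective φ := hψ.comp (Prod.mk_right_injective 0)
  have hper : ∀ d : ZMod q, p • d = 0 → ∀ r, ∑ h, (c (r + d, h) : ℂ) * φ h =
      ∑ h, (c (r, h) : ℂ) * φ h := fun d hd r =>
    fiber_sum_add_torsion hq hpH ψ hψ c hv hd r
  set n : ZMod q → ℤ := fun r => ∑ h, |c (r, h)| with hn
  have hn0 : ∀ r, 0 ≤ n r := fun r => sum_nonneg fun _ _ => abs_nonneg _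
  have hsum : ∑ r, n r ≤ 8 := by rwa [Fintype.sum_prod_type] at hc
  have hone : ∀ r, n r ≤ 8 := fun r =>
    (single_le_sum (fun i _ => hn0 i) (mem_univ r)).trans hsum
  have htwo : ∀ r r', r ≠ r' → n r + n r' ≤ 8 := fun r r' hrr => by
    rw [← sum_pair hrr]
    exact (sum_le_sum_of_subset_of_nonneg (subset_univ _) fun i _ _ => hn0 i).trans hsum
  by_cases hall : ∀ r, ∑ h, (c (r, h) : ℂ) * φ h = 0
  · by_cases hz : ∀ r, (fun h => c (r, h)) = 0
    · left; ext ⟨r, h⟩; exact congrFun (hz r) h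
    · right
      push Not at hz
      obtain ⟨r, hr⟩ := hz
      have main : ∀ p' : ℕ, p'.Prime → 5 ≤ p' → IsTorsionCoset p' (fun h => c (r, h)) →
          IsTorsionCoset p' c := by
        intro p' hp' h5 h
        refine h.of_fiber ?_ r fun r' hr' => ?_
        · rw [ZMod.card, hq]
          refine Nat.Coprime.pow_right _ ((Nat.coprime_primes hp' hpp).2 ?_)
          rintro rfl
          exact h.not_coprime hp'.ne_one hpH
        · have h1 := htwo r' r hr'
          have h2 : n r = p' := h.2
          exact congrFun (hH.eq_zero φ hφ (c := fun h => c (r', h))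
            (show n r' ≤ 4 by omega) (hall r'))
      rcases hH φ hφ _ (hone r) (hall r) with h | h | h
      · exact absurd h hr
      · exact .inl (main 5 (by norm_num) le_rfl h)
      · exact .inr (main 7 (by norm_num) (by norm_num) h)
  · push Not at hall
    obtain ⟨r, hr⟩ := hall
    set T : Finset (ZMod q) := {d : ZMod q | p • d = 0} with hT
    have hTc : #T = p := ZMod.card_filter_nsmul_eq_zero hq
    have hpos : ∀ r, ∑ h, (c (r, h) : ℂ) * φ h ≠ 0 → ∀ d ∈ T, 1 ≤ n (r + d) := by
      intro r hr d hd
      by_contra hlt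
      have h0 : (fun h => c (r + d, h)) = 0 := sum_abs_eq_zero (show n (r + d) ≤ 0 by omega)
      refine hr ?_
      rw [← hper d (by simpa [hT] using hd) r]
      exact sum_eq_zero fun h _ => by rw [show c (r + d, h) = 0 from congrFun h0 h]; simp
    have hle : ∀ r, ∑ d ∈ T, n (r + d) ≤ ∑ d, n d := fun r => by
      rw [← Equiv.sum_comp (Equiv.addLeft r)]
      exact sum_le_sum_of_subset_of_nonneg (subset_univ _) fun i _ _ => hn0 _
    have hsplit : ∀ d ∈ T, n (r + d) + (p - 1) ≤ ∑ d ∈ T, n (r + d) := fun d hd => by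
      rw [← add_sum_erase T _ hd]
      have : ∑ x ∈ T.erase d, (1 : ℤ) ≤ ∑ x ∈ T.erase d, n (r + x) :=
        sum_le_sum fun x hx => hpos r hr x (mem_of_mem_erase hx)
      rw [sum_const, card_erase_of_mem hd, hTc, nsmul_eq_mul, mul_one,
        Nat.cast_sub hpp.one_le, Nat.cast_one] at this
      linarith
    -- Otherwise the p fibres would have total norm at least 2p ≥ 10.
    obtain ⟨d₀, hd₀, hnd₀⟩ : ∃ d ∈ T, n (r + d) = 1 := by
      by_contra! hne
      have : ∑ x ∈ T, (2 : ℤ) ≤ ∑ x ∈ T, n (r + x) := sum_le_sum fun x hx => by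
        have := hne x hx; have := hpos r hr x hx; omega
      rw [sum_const, hTc, nsmul_eq_mul] at this
      have := hle r
      omega
    obtain ⟨w, θ, hθ, hw, hw0⟩ := exists_of_sum_abs_eq_one hnd₀
    have hsame : ∀ d ∈ T, ∀ h, c (r + d, h) = c (r + d₀, h) := by
      intro d hd
      have hd' : p • d = 0 := by simpa [hT] using hd
      have hd₀' : p • d₀ = 0 := by simpa [hT] using hd₀
      have hrel : ∑ h, ((c (r + d, h) - c (r + d₀, h) : ℤ) : ℂ) * φ h = 0 := by
        simp_rw [Int.cast_sub, sub_mul, sum_sub_distrib]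
        rw [hper d hd', hper d₀ hd₀', sub_self]
      have hnorm : ∑ h, |c (r + d, h) - c (r + d₀, h)| ≤ n (r + d) + 1 := by
        rw [← hnd₀, hn, ← sum_add_distrib]
        exact sum_le_sum fun h _ => abs_sub _ _
      have h1 := hsplit d hd
      have h2 := hle r
      have hzero : (fun h => c (r + d, h) - c (r + d₀, h)) = 0 := by
        -- The other p - 1 fibres use at least p - 1 of the norm, so the difference has norm at most
        -- 10 - p ≤ 5. Norm 5 would require p = 5, but H has no 5-torsion then.
        rcases hH φ hφ (fun h => c (r + d, h) - c (r + d₀, h)) (by omega) hrel with h | h | h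
        · exact h
        · have h5 := h.2
          push_cast at h5
          have hp : p = 5 := by omega
          subst hp
          exact (h.not_coprime (by norm_num) hpH).elim
        · have h5 := h.2
          push_cast at h5
          omega
      intro h
      exact sub_eq_zero.1 (congrFun hzero h)
    have hnorm : ∀ d ∈ T, n (r + d) = 1 := fun d hd => by
      rw [← hnd₀, hn]; exact sum_congr rfl fun h _ => by rw [hsame d hd]
    have hTsum : ∑ d ∈ T, n (r + d) = p := by
      rw [sum_congr rfl hnorm]; simp [hTc]
    have hrest : ∀ r', p • (r' - r) ≠ 0 → ∀ h, c (r', h) = 0 := by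
      intro r' hr'
      have hsm : ∑ d ∈ T, n (r + d) + n r' ≤ 8 := by
        refine le_trans ?_ hsum
        rw [← Equiv.sum_comp (Equiv.addLeft r), add_comm]
        have hnot : r' - r ∉ T := by simpa [hT] using hr'
        have := sum_insert (f := fun d => n (r + d)) hnot
        simp only [add_sub_cancel] at this
        rw [← this]
        exact sum_le_sum_of_subset_of_nonneg (subset_univ _) fun i _ _ => hn0 _
      by_cases h0 : ∑ h, (c (r', h) : ℂ) * φ h = 0
      · exact congrFun (hH.eq_zero φ hφ (c := fun h => c (r', h))
          (show n r' ≤ 4 by omega) h0)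
      · exfalso
        -- A second coset with nonzero sums would bring the total norm to at least 2p > 8.
        have hdis : ∑ d ∈ T, n (r + d) + ∑ d ∈ T, n (r' + d) ≤ 8 := by
          refine le_trans ?_ hsum
          have e1 : ∑ d ∈ T, n (r + d) = ∑ x ∈ T.map (addLeftEmbedding r), n x := by simp
          have e2 : ∑ d ∈ T, n (r' + d) = ∑ x ∈ T.map (addLeftEmbedding r'), n x := by simp
          rw [e1, e2, ← sum_union]
          · exact sum_le_sum_of_subset_of_nonneg (subset_univ _) fun i _ _ => hn0 _
          · rw [disjoint_left]
            simp only [mem_map, addLeftEmbedding_apply, hT, mem_filter, mem_univ, true_and]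
            rintro x ⟨d, hd, rfl⟩ ⟨d', hd', he⟩
            refine hr' ?_
            have : r' - r = d - d' := by
              rw [sub_eq_sub_iff_add_eq_add, he]; abel
            rw [this, smul_sub, hd, hd', sub_zero]
        have : ∑ x ∈ T, (1 : ℤ) ≤ ∑ x ∈ T, n (r' + x) :=
          sum_le_sum fun x hx => hpos r' h0 x hx
        rw [sum_const, hTc, nsmul_eq_mul] at this
        omega
    have hp7 : p = 5 ∨ p = 7 := by
      have h1 := hle r
      have : p ≤ 8 := by omega
      interval_cases p
      · exact .inl rfl
      · exact absurd hpp (by norm_num)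
      · exact .inr rfl
      · exact absurd hpp (by norm_num)
    have hres : IsTorsionCoset p c := by
      refine ⟨⟨(r, w), θ, hθ, ?_, ?_⟩, ?_⟩
      · rintro ⟨x, y⟩ hk
        rw [Prod.mk_sub_mk, Prod.smul_mk, Prod.mk_eq_zero] at hk
        obtain rfl := sub_eq_zero.1 (eq_zero_of_coprime_nsmul hpH hk.2)
        have := hsame (x - r) (by simpa [hT] using hk.1) y
        rw [add_sub_cancel] at this
        rw [this, hw]
      · rintro ⟨x, y⟩ hk
        by_cases hx : p • (x - r) = 0
        · have := hsame (x - r) (by simpa [hT] using hx) y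
          rw [add_sub_cancel] at this
          rw [this, hw0 y]
          rintro rfl
          exact hk (by simp [hx])
        · exact hrest x hx y
      · rw [Fintype.sum_prod_type, ← hTsum]
        change ∑ x, n x = _
        rw [← Equiv.sum_comp (Equiv.addLeft r)]
        symm
        refine sum_subset (subset_univ _) fun d _ hd => ?_
        exact sum_eq_zero fun h _ => by
          rw [hrest _ (by simpa [hT] using hd), abs_zero]
    rcases hp7 with rfl | rfl
    · exact .inr (.inl hres)
    · exact .inr (.inr hres)

/-- The prime-power parts of N are split off one at a time; over the trivial group a vanishing sum
has zero coefficient. -/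
theorem shortSums_zmod (N : ℕ) [hN0 : NeZero N] (hN : N.Coprime 6) : ShortSums (ZMod N) := by
  induction N using Nat.strong_induction_on generalizing hN0 with
  | _ N ih =>
    rcases eq_or_ne N 1 with rfl | h1
    · intro ψ _ c _ h
      left
      funext k
      rw [Fintype.sum_unique] at h
      rcases mul_eq_zero.1 h with h | h
      · rw [Subsingleton.elim k default]; exact_mod_cast h
      · exact absurd h (AddChar.val_isUnit ψ _).ne_zero
    · obtain ⟨p, hp, hpN⟩ := Nat.exists_prime_and_dvd h1
      have : Fact p.Prime := ⟨hp⟩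
      obtain ⟨e, M, hM, hNe⟩ := Nat.exists_eq_pow_mul_and_not_dvd hN0.out p hp.ne_one
      obtain _ | a := e
      · rw [pow_zero, one_mul] at hNe; exact absurd (hNe ▸ hpN) hM
      have hcop : p.Coprime M := (Nat.Prime.coprime_iff_not_dvd hp).2 hM
      have hp6 : p.Coprime 6 := hN.coprime_dvd_left hpN
      have hp5 : 5 ≤ p := by
        have := hp.two_le
        by_contra! hlt
        interval_cases p <;> revert hp6 <;> decide
      have hM0 : M ≠ 0 := by rintro rfl; simp at hM
      have : NeZero M := ⟨hM0⟩
      have : NeZero (p ^ (a + 1)) := ⟨pow_ne_zero _ hp.ne_zero⟩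
      have hlt : M < N := by
        rw [hNe]
        exact lt_mul_of_one_lt_left (Nat.pos_of_ne_zero hM0) (Nat.one_lt_pow (by simp) hp.one_lt)
      have hMs : ShortSums (ZMod M) := ih M hlt
        (hN.coprime_dvd_left (hNe ▸ dvd_mul_left M _))
      have hprod : ShortSums (ZMod (p ^ (a + 1)) × ZMod M) :=
        hMs.prod hp5 rfl (by rwa [ZMod.card])
      subst hNe
      exact hprod.of_addEquiv (ZMod.chineseRemainder (hcop.pow_left _)).symm.toAddEquiv

/-! ### Symmetric vanishing sums with a 3-part -/

theorem eq_zero_of_neg_eq_self {H : Type*} [AddCommGroup H] [Fintype H]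
    (hH : Nat.Coprime 2 (Fintype.card H)) {x : H} (hx : -x = x) : x = 0 :=
  eq_zero_of_coprime_nsmul hH (by rw [two_nsmul, ← neg_eq_iff_add_eq_zero, hx])

theorem even_sum_of_symm {H : Type*} [AddCommGroup H] [Fintype H]
    (hH : Nat.Coprime 2 (Fintype.card H)) {f : H → ℤ} (hf : ∀ k, f (-k) = f k)
    (h0 : Even (f 0)) : Even (∑ k, f k) := by
  rw [← ZMod.intCast_eq_zero_iff_even, Int.cast_sum]
  refine sum_involution (fun k _ => -k) (fun k _ => ?_) (fun k _ hk hneg => hk ?_)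
    (fun _ _ => mem_univ _) (fun k _ => neg_neg k)
  · rw [hf]; exact CharTwo.add_self_eq_zero _
  · rw [eq_zero_of_neg_eq_self hH hneg]
    exact ZMod.intCast_eq_zero_iff_even.2 h0

/-- The sum of absolute values exceeds the sum by twice the sum of the negative parts. That last sum
is even, because negation pairs the nonzero elements. -/
theorem four_dvd_sum_abs_of_symm {H : Type*} [AddCommGroup H] [Fintype H]
    (hH : Nat.Coprime 2 (Fintype.card H)) {f : H → ℤ} (hf : ∀ k, f (-k) = f k)
    (h0 : Even (f 0)) (h4 : 4 ∣ ∑ k, f k) : 4 ∣ ∑ k, |f k| := by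
  have h1 : ∀ k, |f k| = f k + 2 * max (-f k) 0 := fun k => by
    rcases abs_cases (f k) with h | h <;> omega
  have h2 : Even (∑ k, max (-f k) 0) := even_sum_of_symm hH (fun k => by rw [hf]) (by
    rcases max_choice (-f 0) 0 with h | h <;> rw [h]
    · exact h0.neg
    · exact Even.zero)
  simp_rw [h1, sum_add_distrib, ← mul_sum]
  obtain ⟨m, hm⟩ := h2
  omega

/-- This parity rules out the odd norms 5 and 7 for differences of fibres. -/
theorem even_sum_abs_sub {H : Type*} [Fintype H] (f g : H → ℤ) :
    Even (∑ k, |f k - g k| - (∑ k, |f k| + ∑ k, |g k|)) := by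
  rw [← sum_add_distrib, ← sum_sub_distrib]
  refine even_sum _ fun k _ => ?_
  rw [Int.even_sub, Int.even_add, even_abs, even_abs, even_abs, Int.even_sub]

/-- The shape of `± (∑ fifth roots of unity + ∑ cube roots of unity)`. -/
def IsQuinticType {Q H : Type*} [AddCommGroup Q] [AddCommGroup H] [Fintype Q] [Fintype H]
    (c : Q × H → ℤ) : Prop :=
  ∑ k, |c k| = 8 ∧ ∑ h, |c (0, h)| = 6 ∧ (∀ r, r ≠ 0 → ∀ h, h ≠ 0 → c (r, h) = 0) ∧
    (∃ h, h ≠ 0 ∧ c (0, h) ≠ 0) ∧ ∃ θ, (θ = 1 ∨ θ = -1) ∧ ∀ k, 0 ≤ θ * c k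

/-- Norm eight, supported on the 3-torsion of the first factor, with opposite signs on and off the
zero fibre. -/
def IsSignSplit {Q H : Type*} [AddCommGroup Q] [AddCommGroup H] [Fintype Q] [Fintype H]
    (c : Q × H → ℤ) : Prop :=
  ∑ k, |c k| = 8 ∧ (∀ r, 3 • r ≠ 0 → ∀ h, c (r, h) = 0) ∧ ∃ θ, (θ = 1 ∨ θ = -1) ∧
    (∀ h, 0 ≤ θ * c (0, h)) ∧ (∀ r, r ≠ 0 → ∀ h, θ * c (r, h) ≤ 0)

/-- The shape of `± (∑ seventh roots of unity - ∑ cube roots of unity)`. -/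
def IsSepticType {Q H : Type*} [AddCommGroup Q] [AddCommGroup H] [Fintype Q] [Fintype H]
    (c : Q × H → ℤ) : Prop :=
  IsSignSplit c ∧ ∑ h, |c (0, h)| = 6 ∧ (∀ r, r ≠ 0 → ∀ h, h ≠ 0 → c (r, h) = 0) ∧ c (0, 0) = 0

/-- The shape of a sum of fifth roots of unity, three of which are rewritten by cube roots of
unity. -/
def IsMixedType {Q H : Type*} [AddCommGroup Q] [AddCommGroup H] [Fintype Q] [Fintype H]
    (c : Q × H → ℤ) : Prop :=
  IsSignSplit c ∧ ∑ h, |c (0, h)| = 2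

theorem exists_three_torsion {a q : ℕ} [NeZero q] (hq : q = 3 ^ (a + 1)) :
    ∃ t : ZMod q, t ≠ 0 ∧ t ≠ -t ∧
      ({d : ZMod q | 3 • d = 0} : Finset (ZMod q)) = {0, t, -t} := by
  have hc : #{d : ZMod q | 3 • d = 0} = 3 := ZMod.card_filter_nsmul_eq_zero hq
  obtain ⟨t, ht, ht0⟩ : ∃ t ∈ ({d : ZMod q | 3 • d = 0} : Finset (ZMod q)), t ≠ 0 :=
    exists_mem_ne (by omega) 0
  have h2 : Nat.Coprime 2 (Fintype.card (ZMod q)) := by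
    rw [ZMod.card, hq]; exact Nat.Coprime.pow_right _ (by norm_num)
  have htt : t ≠ -t := fun h => ht0 (eq_zero_of_neg_eq_self h2 h.symm)
  refine ⟨t, ht0, htt, (eq_of_subset_of_card_le ?_ ?_).symm⟩
  · intro d hd
    simp only [mem_filter, mem_univ, true_and] at ht
    simp only [mem_insert, mem_singleton] at hd
    rcases hd with rfl | rfl | rfl
    · simp
    · simpa using ht
    · simp only [mem_filter, mem_univ, true_and, smul_neg, ht, neg_zero]
  · rw [hc, card_insert_of_notMem, card_pair htt]
    simp [ht0, Ne.symm ht0]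

/-- A symmetric coset contains both w and -w, so 2w is p-torsion. In odd order w is p-torsion too,
and the coset is the torsion subgroup itself. -/
theorem IsTorsionCoset.symm {H : Type*} [AddCommGroup H] [Fintype H] {p : ℕ} {c : H → ℤ}
    (hH : Nat.Coprime 2 (Fintype.card H))
    (h : IsTorsionCoset p c) (hc : ∀ k, c (-k) = c k) :
    ∃ θ, (θ = 1 ∨ θ = -1) ∧ c 0 = θ ∧ ∀ k, c k = θ ∨ c k = 0 := by
  obtain ⟨⟨w, θ, hθ, h1, h2⟩, -⟩ := h
  have hw : c (-w) = θ := by rw [hc]; exact h1 w (by simp)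
  have hw2 : p • (-w - w) = 0 := by
    by_contra h0
    have := h2 _ h0
    rw [hw] at this
    omega
  have hw3 : p • w = 0 := eq_zero_of_coprime_nsmul hH <| by
    have : -w - w = -(2 • w) := by rw [two_nsmul]; abel
    rw [this, smul_neg, neg_eq_zero, smul_comm] at hw2
    exact hw2
  refine ⟨θ, hθ, h1 0 (by simp [hw3]), fun k => ?_⟩
  by_cases hk : p • (k - w) = 0
  · exact .inl (h1 k hk)
  · exact .inr (h2 k hk)

/-- By symmetry and divisibility of the norm by 4, only the fibres over 0, t and -t survive, t being
3-torsion. They have equal sums, so their differences are short vanishing sums over H, and a count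
of norms leaves the listed shapes. -/
theorem vanishing_symm_classification {a q : ℕ} [NeZero q] (hq : q = 3 ^ (a + 1))
    {H : Type*} [AddCommGroup H] [Fintype H]
    (hH2 : Nat.Coprime 2 (Fintype.card H)) (hH3 : Nat.Coprime 3 (Fintype.card H))
    (hH : ShortSums H) (ψ : AddChar (ZMod q × H) ℂ) (hψ : Function.Injective ψ)
    (c : ZMod q × H → ℤ) (hsymm : ∀ k, c (-k) = c k) (heven : Even (c 0)) (h4 : 4 ∣ ∑ k, c k)
    (hc : ∑ k, |c k| ≤ 8) (hv : ∑ k, (c k : ℂ) * ψ k = 0) :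
    c = 0 ∨ IsQuinticType c ∨ IsSepticType c ∨ IsMixedType c := by
  have : Fact (Nat.Prime 3) := ⟨Nat.prime_three⟩
  have hq2 : Nat.Coprime 2 (Fintype.card (ZMod q)) := by
    rw [ZMod.card, hq]; exact Nat.Coprime.pow_right _ (by norm_num)
  have h4n : 4 ∣ ∑ k, |c k| := four_dvd_sum_abs_of_symm (by
    rw [Fintype.card_prod]; exact Nat.Coprime.mul_right hq2 hH2) hsymm heven h4
  let φ : AddChar H ℂ := ψ.compAddMonoidHom (AddMonoidHom.inr (ZMod q) H)
  have hφ : Function.Injective φ := hψ.comp (Prod.mk_right_injective 0)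
  have hper : ∀ d : ZMod q, 3 • d = 0 → ∀ r, ∑ h, (c (r + d, h) : ℂ) * φ h =
      ∑ h, (c (r, h) : ℂ) * φ h := fun d hd r =>
    fiber_sum_add_torsion hq hH3 ψ hψ c hv hd r
  set n : ZMod q → ℤ := fun r => ∑ h, |c (r, h)| with hn
  have hn0 : ∀ r, 0 ≤ n r := fun r => sum_nonneg fun _ _ => abs_nonneg _
  rw [Fintype.sum_prod_type] at hc h4n
  change ∑ r, n r ≤ 8 at hc
  change 4 ∣ ∑ r, n r at h4n
  have hsub : ∀ s : Finset (ZMod q), ∑ r ∈ s, n r ≤ 8 := fun s =>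
    (sum_le_sum_of_subset_of_nonneg (subset_univ _) fun i _ _ => hn0 i).trans hc
  have hcs : ∀ r h, c (-r, -h) = c (r, h) := fun r h => hsymm (r, h)
  have hnsymm : ∀ r, n (-r) = n r := fun r => by
    rw [hn]
    simp only
    rw [← Equiv.sum_comp (Equiv.neg H)]
    exact sum_congr rfl fun h _ => by rw [Equiv.neg_apply, hcs]
  have hneg : ∀ r : ZMod q, r ≠ 0 → -r ≠ r := fun r hr h => hr (eq_zero_of_neg_eq_self hq2 h)
  -- The fibre over -r has the same norm, so each has norm at most 4, below the shortest nontrivial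
  -- relation.
  have hvan : ∀ r, r ≠ 0 → ∑ h, (c (r, h) : ℂ) * φ h = 0 → ∀ h, c (r, h) = 0 := fun r hr h0 => by
    have h1 := hsub {-r, r}
    rw [sum_pair (hneg r hr), hnsymm] at h1
    exact congrFun (hH.eq_zero φ hφ (c := fun h => c (r, h)) (show n r ≤ 4 by omega) h0)
  have hn0even : Even (n 0) := even_sum_of_symm hH2 (fun h => by
    rw [← neg_zero, hcs, neg_zero]) (even_abs.2 heven)
  obtain ⟨t, ht0, htt, hT⟩ := exists_three_torsion hq
  have hTmem : ∀ d : ZMod q, 3 • d = 0 ↔ d = 0 ∨ d = t ∨ d = -t := fun d => by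
    simpa using Finset.ext_iff.1 hT d
  set T : Finset (ZMod q) := {d : ZMod q | 3 • d = 0} with hTdef
  have hTc : #T = 3 := ZMod.card_filter_nsmul_eq_zero hq
  have hTsum : ∀ f : ZMod q → ℤ, ∑ d ∈ T, f d = f 0 + f t + f (-t) := fun f => by
    rw [hT, sum_insert, sum_pair htt, add_assoc]
    simp [ht0, Ne.symm ht0]
  have ht3 : 3 • t = 0 := (hTmem t).2 (by simp)
  have ht3' : 3 • (-t) = 0 := (hTmem (-t)).2 (by simp)
  have hpos : ∀ r, ∑ h, (c (r, h) : ℂ) * φ h ≠ 0 → 1 ≤ n r := by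
    intro r hr
    by_contra hlt
    have h0 : (fun h => c (r, h)) = 0 := sum_abs_eq_zero (show n r ≤ 0 by omega)
    exact hr (sum_eq_zero fun h _ => by rw [show c (r, h) = 0 from congrFun h0 h]; simp)
  have hposT : ∀ r, ∑ h, (c (r, h) : ℂ) * φ h ≠ 0 → ∀ d ∈ T, 1 ≤ n (r + d) := fun r hr d hd =>
    hpos _ (by rw [hper d (by simpa [hTdef] using hd)]; exact hr)
  have hrel : ∀ r r', ∑ h, (c (r, h) : ℂ) * φ h = ∑ h, (c (r', h) : ℂ) * φ h →
      ∑ h, ((c (r, h) - c (r', h) : ℤ) : ℂ) * φ h = 0 := fun r r' h => by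
    simp_rw [Int.cast_sub, sub_mul, sum_sub_distrib]
    rw [h, sub_self]
  have hnorm : ∀ r r', ∑ h, |c (r, h) - c (r', h)| ≤ n r + n r' := fun r r' => by
    rw [hn, ← sum_add_distrib]
    exact sum_le_sum fun h _ => abs_sub _ _
  have hdisj : ∀ x y, 3 • (x - y) ≠ 0 →
      Disjoint (T.map (addLeftEmbedding x)) (T.map (addLeftEmbedding y)) := by
    intro x y hxy
    rw [disjoint_left]
    simp only [mem_map, addLeftEmbedding_apply, hTdef, mem_filter, mem_univ, true_and]
    rintro _ ⟨d, hd, rfl⟩ ⟨d', hd', he⟩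
    refine hxy ?_
    have : x - y = d' - d := by
      rw [sub_eq_sub_iff_add_eq_add, ← he]; abel
    rw [this, smul_sub, hd, hd', sub_zero]
  have hsumT : ∀ x, ∑ r ∈ T.map (addLeftEmbedding x), n r = n x + n (x + t) + n (x - t) :=
    fun x => by rw [sum_map, hTsum]; simp [sub_eq_add_neg]
  -- the fibres off the 3-torsion vanish
  have hoff : ∀ r, 3 • r ≠ 0 → ∑ h, (c (r, h) : ℂ) * φ h = 0 := by
    intro r hr3
    by_contra hr
    have h2r : 3 • (r - -r) ≠ 0 := fun h => hr3 <| eq_zero_of_coprime_nsmul hq2 <| by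
      rw [sub_neg_eq_add, ← two_nsmul, smul_comm] at h; exact h
    have hA' : n (-r) + n (-r + t) + n (-r - t) = n r + n (r + t) + n (r - t) := by
      rw [← hnsymm (-r + t), ← hnsymm (-r - t), hnsymm r,
        show -(-r + t) = r - t by abel, show -(-r - t) = r + t by abel]; ring
    have hU := hsub (T.map (addLeftEmbedding r) ∪ T.map (addLeftEmbedding (-r)))
    rw [sum_union (hdisj _ _ h2r), hsumT, hsumT, hA'] at hU
    have p0 := hpos r hr
    have p1 := hposT r hr t (by simpa [hTdef] using ht3)
    have p2 := hposT r hr (-t) (by simpa [hTdef] using ht3')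
    rw [← sub_eq_add_neg] at p2
    have e1 : (fun h => c (r + t, h) - c (r, h)) = 0 := hH.eq_zero φ hφ
      ((hnorm _ _).trans (by omega)) (hrel _ _ (hper t ht3 r))
    have e2 : (fun h => c (r - t, h) - c (r, h)) = 0 := hH.eq_zero φ hφ
      ((hnorm _ _).trans (by omega))
      (hrel _ _ (by rw [sub_eq_add_neg]; exact hper (-t) ht3' r))
    have e1' : n (r + t) = n r := sum_congr rfl fun h _ => by
      rw [sub_eq_zero.1 (congrFun e1 h)]
    have e2' : n (r - t) = n r := sum_congr rfl fun h _ => by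
      rw [sub_eq_zero.1 (congrFun e2 h)]
    -- The two disjoint cosets of r and -r have equal norm, at least 3 and at most 4, shared equally
    -- by three fibres; hence 3 each. What remains is too small to survive, and a total of 6
    -- contradicts divisibility by 4.
    have htot : ∑ s, n s = 6 := by
      rw [← sum_subset (subset_univ (T.map (addLeftEmbedding r) ∪ T.map (addLeftEmbedding (-r))))]
      · rw [sum_union (hdisj _ _ h2r), hsumT, hsumT, hA']; omega
      · intro s _ hs
        rw [mem_union, not_or] at hs
        have hs' : ∀ y, s ∉ T.map (addLeftEmbedding y) → 3 • (s - y) ≠ 0 := by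
          intro y hy h3
          refine hy (mem_map.2 ⟨s - y, ?_, by simp⟩)
          simpa [hTdef] using h3
        have hlt : n s + n (s + t) + n (s - t) ≤ 2 := by
          have := hsub (T.map (addLeftEmbedding r) ∪ T.map (addLeftEmbedding (-r)) ∪
            T.map (addLeftEmbedding s))
          rw [sum_union (disjoint_union_left.2
            ⟨(hdisj _ _ (hs' _ hs.1)).symm, (hdisj _ _ (hs' _ hs.2)).symm⟩),
            sum_union (hdisj _ _ h2r), hsumT, hsumT, hsumT, hA'] at this
          omega
        have hS : ∑ h, (c (s, h) : ℂ) * φ h = 0 := by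
          by_contra hS
          have p0 := hpos s hS
          have p1 := hposT s hS t (by simpa [hTdef] using ht3)
          have p2 := hposT s hS (-t) (by simpa [hTdef] using ht3')
          rw [← sub_eq_add_neg] at p2
          omega
        have := hn0 (s + t)
        have := hn0 (s - t)
        have := hH.eq_zero φ hφ (c := fun h => c (s, h)) (show n s ≤ 4 by omega) hS
        exact sum_eq_zero fun h _ => by rw [show c (s, h) = 0 from congrFun this h, abs_zero]
    omega
  have hoff' : ∀ r, 3 • r ≠ 0 → ∀ h, c (r, h) = 0 := fun r hr =>
    hvan r (by rintro rfl; simp at hr) (hoff r hr)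
  have htot : ∑ r, n r = n 0 + 2 * n t := by
    rw [← sum_subset (subset_univ T), hTsum, hnsymm]
    · ring
    · intro r _ hr
      exact sum_eq_zero fun h _ => by rw [hoff' r (by simpa [hTdef] using hr), abs_zero]
  have htot' : ∑ k, |c k| = n 0 + 2 * n t := by rw [Fintype.sum_prod_type]; exact htot
  by_cases h0 : ∑ h, (c (0, h) : ℂ) * φ h = 0
  · left
    have hT0 : ∀ r, 3 • r = 0 → ∑ h, (c (r, h) : ℂ) * φ h = 0 := fun r hr => by
      have := hper r hr 0
      rw [zero_add] at this
      rw [this, h0]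
    have hr0 : ∀ r, r ≠ 0 → ∀ h, c (r, h) = 0 := fun r hr => by
      by_cases h3 : 3 • r = 0
      · exact hvan r hr (hT0 r h3)
      · exact hoff' r h3
    have h00 : (fun h => c (0, h)) = 0 := by
      have h8 : n 0 ≤ 8 := by simpa using hsub {0}
      rcases hH φ hφ _ h8 h0 with h | h | h
      · exact h
      · have : n 0 = 5 := h.2
        rw [this] at hn0even; exact absurd hn0even (by decide)
      · have : n 0 = 7 := h.2
        rw [this] at hn0even; exact absurd hn0even (by decide)
    funext ⟨r, h⟩
    by_cases hr : r = 0
    · subst hr; exact congrFun h00 h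
    · exact hr0 r hr h
  · right
    have p0 := hpos 0 h0
    have ht : ∑ h, (c (t, h) : ℂ) * φ h = ∑ h, (c (0, h) : ℂ) * φ h := by
      simpa using hper t ht3 0
    have ht' : ∑ h, (c (-t, h) : ℂ) * φ h = ∑ h, (c (0, h) : ℂ) * φ h := by
      simpa using hper (-t) ht3' 0
    have p1 := hpos t (by rwa [ht])
    obtain ⟨m₀, hm₀⟩ := hn0even
    have hpar := fun r r' => even_sum_abs_sub (fun h => c (r, h)) (fun h => c (r', h))
    change ∀ r r', Even (∑ h, |c (r, h) - c (r', h)| - (n r + n r')) at hpar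
    -- The difference has even norm at most 2 n(t) ≤ 6, so it is neither of the two nontrivial
    -- relations.
    have htneg : ∀ h, c (-t, h) = c (t, h) := by
      obtain ⟨m, hm⟩ := hpar (-t) t
      have hle := hnorm (-t) t
      rw [hnsymm] at hm hle
      have : (fun h => c (-t, h) - c (t, h)) = 0 := by
        rcases hH φ hφ (fun h => c (-t, h) - c (t, h)) (by omega) (hrel _ _ (ht'.trans ht.symm))
          with h | h | h
        · exact h
        · have := h.2; push_cast at this; omega
        · have := h.2; push_cast at this; omega
      exact fun h => sub_eq_zero.1 (congrFun this h)
    have htsymm : ∀ h, c (t, -h) = c (t, h) := fun h => by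
      rw [← htneg, hcs]
    have hcT : ∀ r, r ≠ 0 → ∀ h, c (r, h) = c (t, h) ∨ c (r, h) = 0 := by
      intro r hr h
      by_cases h3 : 3 • r = 0
      · rcases (hTmem r).1 h3 with rfl | rfl | rfl
        · exact absurd rfl hr
        · exact .inl rfl
        · exact .inl (htneg h)
      · exact .inr (hoff' r h3 h)
    have hesymm : ∀ h, c (0, -h) - c (t, -h) = c (0, h) - c (t, h) := fun h => by
      rw [htsymm]
      have := hcs 0 h
      rw [neg_zero] at this
      rw [this]
    obtain ⟨m, hm⟩ := hpar 0 t
    have hle := hnorm 0 t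
    have hsplit : ∑ h, |c (0, h) - c (t, h)| = n 0 + n t →
        ∀ h, |c (0, h) - c (t, h)| = |c (0, h)| + |c (t, h)| := by
      intro he h
      rw [hn, ← sum_add_distrib] at he
      exact (sum_eq_sum_iff_of_le fun h _ => abs_sub (c (0, h)) (c (t, h))).1 he h (mem_univ h)
    have hsigns : ∀ θ, (θ = 1 ∨ θ = -1) →
        (∀ h, c (0, h) - c (t, h) = θ ∨ c (0, h) - c (t, h) = 0) →
        ∑ h, |c (0, h) - c (t, h)| = n 0 + n t → n 0 + 2 * n t = 8 → IsSignSplit c := by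
      intro θ hθ hval he h8
      have hs : ∀ h, 0 ≤ θ * c (0, h) ∧ θ * c (t, h) ≤ 0 := fun h => by
        have h1 := hsplit he h
        have h2 := hval h
        rcases hθ with rfl | rfl <;>
        rcases abs_cases (c (0, h)) with h3 | h3 <;> rcases abs_cases (c (t, h)) with h4 | h4 <;>
        rcases abs_cases (c (0, h) - c (t, h)) with h5 | h5 <;> omega
      refine ⟨htot'.trans h8, hoff', θ, hθ, fun h => (hs h).1, fun r hr h => ?_⟩
      rcases hcT r hr h with h1 | h1
      · rw [h1]; exact (hs h).2
      · simp [h1]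
    have hsingle : n t = 1 → ∃ θ, (θ = 1 ∨ θ = -1) ∧ c (t, 0) = θ ∧
        ∀ h, h ≠ 0 → c (t, h) = 0 := by
      intro h1
      obtain ⟨w, θ, hθ, hw, hw0⟩ := exists_of_sum_abs_eq_one h1
      have : w = 0 := by
        refine eq_zero_of_neg_eq_self hH2 ?_
        by_contra hne
        have h2 := hw0 _ hne
        rw [htsymm, hw] at h2
        omega
      subst this
      exact ⟨θ, hθ, hw, hw0⟩
    -- Here n(0) is even and positive, and n(0) + 2 n(t) is 4 or 8. The difference has norm at most
    -- n(0) + n(t) and of the same parity. Norm 0 would give total 6; norm 5 leaves (n(0), n(t)) =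
    -- (2, 3) or (6, 1); norm 7 leaves (6, 1).
    rcases hH φ hφ (fun h => c (0, h) - c (t, h)) (by omega) (hrel _ _ ht.symm) with h | h | h
    · exfalso
      have : n 0 = n t := sum_congr rfl fun k _ => by rw [sub_eq_zero.1 (congrFun h k)]
      omega
    · obtain ⟨θ, hθ, he0, hev⟩ := h.symm hH2 hesymm
      have h5 := h.2
      push_cast at h5
      have hcases : n 0 = 2 ∧ n t = 3 ∨ n 0 = 6 ∧ n t = 1 := by omega
      rcases hcases with ⟨hn2, hn3⟩ | ⟨hn6, hn1⟩
      · exact .inr (.inr ⟨hsigns θ hθ hev (by omega) (by omega), hn2⟩)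
      · left
        obtain ⟨θ', hθ', ht0', htz⟩ := hsingle hn1
        -- Opposite signs would cancel in c (0, 0), so the difference would have norm at least n(0)
        -- = 6 instead of 5.
        have hθθ : θ' = θ := by
          by_contra hne
          have hb : n 0 ≤ ∑ h, |c (0, h) - c (t, h)| := by
            refine sum_le_sum fun h _ => ?_
            by_cases hh : h = 0
            · subst hh
              have : c (0, 0) = 0 := by omega
              rw [this, abs_zero]; exact abs_nonneg _
            · rw [htz h hh, sub_zero]
          omega
        subst hθθ
        refine ⟨by omega, hn6, fun r hr h hh => ?_, ?_, θ', hθ, ?_⟩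
        · rcases hcT r hr h with h1 | h1
          · rw [h1, htz h hh]
          · exact h1
        · by_contra! hall
          have : ∑ h, |c (0, h) - c (t, h)| = |c (0, 0) - c (t, 0)| :=
            Fintype.sum_eq_single 0 fun h hh => by rw [hall h hh, htz h hh]; simp
          rw [he0] at this
          rcases hθ with rfl | rfl <;> simp at this <;> omega
        · have htpos : ∀ h, 0 ≤ θ' * c (t, h) := fun h => by
            by_cases hh : h = 0
            · subst hh; rw [ht0']; exact mul_self_nonneg _
            · rw [htz h hh, mul_zero]
          rintro ⟨r, h⟩
          by_cases hr : r = 0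
          · subst hr
            have h1 := htpos h
            have h2 := hev h
            rcases hθ with rfl | rfl <;> omega
          · rcases hcT r hr h with h1 | h1
            · rw [h1]; exact htpos h
            · rw [h1, mul_zero]
    · obtain ⟨θ, hθ, he0, hev⟩ := h.symm hH2 hesymm
      have h7 := h.2
      push_cast at h7
      have hn61 : n 0 = 6 ∧ n t = 1 := by omega
      obtain ⟨hn6, hn1⟩ := hn61
      obtain ⟨θ', hθ', ht0', htz⟩ := hsingle hn1
      refine .inr (.inl ⟨hsigns θ hθ hev (by omega) (by omega), hn6, fun r hr h hh => ?_, ?_⟩)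
      · rcases hcT r hr h with h1 | h1
        · rw [h1, htz h hh]
        · exact h1
      · have h1 := hsplit (by omega) 0
        rw [he0, ht0'] at h1
        have h2 : |θ| = 1 := by rcases hθ with rfl | rfl <;> simp
        have h3 : |θ'| = 1 := by rcases hθ' with rfl | rfl <;> simp
        rw [h2, h3] at h1
        exact abs_eq_zero.1 (by omega)

/-! ### Derivatives of Boolean functions on the cube -/

/-- Binary encoding of the points of the cube. -/
def cubeIndex (x : Fin 3 → ZMod 2) : ℕ :=
  (x 0).val + 2 * (x 1).val + 4 * (x 2).val

theorem cubeIndex_injective : Function.Injective cubeIndex := by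
  have : ∀ x y, cubeIndex x = cubeIndex y → x = y := by decide +kernel
  exact fun x y h => this x y h

theorem cubeIndex_add (x y : Fin 3 → ZMod 2) :
    cubeIndex (x + y) = cubeIndex x ^^^ cubeIndex y := by
  revert x y
  decide +kernel

theorem image_cubeIndex : univ.image cubeIndex = range 8 := by
  decide +kernel

theorem cubeIndex_lt (x : Fin 3 → ZMod 2) : cubeIndex x < 8 := by
  rw [← mem_range, ← image_cubeIndex]
  exact mem_image_of_mem _ (mem_univ x)

theorem exists_cubeIndex_eq {i : ℕ} (hi : i < 8) : ∃ x, cubeIndex x = i := by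
  rw [← mem_range, ← image_cubeIndex] at hi
  simpa using hi

theorem cubeIndex_ne_zero {x : Fin 3 → ZMod 2} (hx : x ≠ 0) : cubeIndex x ≠ 0 :=
  fun h => hx (cubeIndex_injective (h.trans (by decide)))

/-- The weight of the derivative in the direction `u` of the Boolean function encoded by `n`. -/
def derivWeight (n u : ℕ) : ℕ :=
  (n >>> 0 ^^^ n >>> (0 ^^^ u)) % 2 + (n >>> 1 ^^^ n >>> (1 ^^^ u)) % 2 +
    (n >>> 2 ^^^ n >>> (2 ^^^ u)) % 2 + (n >>> 3 ^^^ n >>> (3 ^^^ u)) % 2 +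
    (n >>> 4 ^^^ n >>> (4 ^^^ u)) % 2 + (n >>> 5 ^^^ n >>> (5 ^^^ u)) % 2 +
    (n >>> 6 ^^^ n >>> (6 ^^^ u)) % 2 + (n >>> 7 ^^^ n >>> (7 ^^^ u)) % 2

theorem derivWeight_eq_sum (n u : ℕ) :
    derivWeight n u = ∑ i ∈ range 8, if n.testBit i ≠ n.testBit (i ^^^ u) then 1 else 0 := by
  have h : ∀ i j, (if n.testBit i ≠ n.testBit j then 1 else 0) = (n >>> i ^^^ n >>> j) % 2 := by
    intro i j
    have h1 := Nat.testBit_xor (n >>> i) (n >>> j) 0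
    rw [Nat.testBit_shiftRight, Nat.testBit_shiftRight, Nat.testBit_zero, add_zero, add_zero] at h1
    cases hi : n.testBit i <;> cases hj : n.testBit j <;> simp [hi, hj] at h1 ⊢ <;> omega
  simp_rw [h]
  simp [derivWeight, sum_range_succ]

theorem exists_encoding (b : (Fin 3 → ZMod 2) → Bool) :
    ∃ n < 256, (∀ x, b x = n.testBit (cubeIndex x)) ∧
      ∀ u, #{x | b x ≠ b (x + u)} = derivWeight n (cubeIndex u) := by
  let n := Nat.ofBits fun i : Fin 8 => b (Function.invFun cubeIndex i)
  have hn : ∀ x, b x = n.testBit (cubeIndex x) := fun x => by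
    simp [n, Nat.testBit_ofBits_lt, cubeIndex_lt,
      Function.leftInverse_invFun cubeIndex_injective _]
  refine ⟨n, Nat.ofBits_lt_two_pow _, hn, fun u => ?_⟩
  rw [derivWeight_eq_sum, ← image_cubeIndex,
    sum_image fun _ _ _ _ h => cubeIndex_injective h, card_filter]
  exact sum_congr rfl fun x _ => by rw [← cubeIndex_add, ← hn, ← hn]

/-- The derivative weight is 2(wt b - s), where s counts the x with b(x) = b(x + u) = 1. Translation
by u makes s even, so the residue depends only on the parity of wt b. The kernel checks all 256
functions. -/
theorem derivWeight_mod_four : ∀ n < 256,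
    (∀ u < 8, u ≠ 0 → derivWeight n u % 4 = 0) ∨ (∀ u < 8, u ≠ 0 → derivWeight n u % 4 = 2) := by
  decide +kernel

-- These are the functions of degree at most 2. The associated alternating form on a 3-dimensional
-- space has radical of dimension 3 or 1; derivatives are constant along the radical and balanced
-- elsewhere.
set_option synthInstance.maxHeartbeats 400000 in
set_option synthInstance.maxSize 1000 in
theorem derivWeight_even : ∀ n < 256, (∀ u < 8, u ≠ 0 → derivWeight n u % 4 = 0) →
    (∀ u < 8, u ≠ 0 → derivWeight n u ≠ 4) ∨ ∃ u₀ < 8, u₀ ≠ 0 ∧ derivWeight n u₀ ≠ 4 ∧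
      ∀ u < 8, u ≠ 0 → u ≠ u₀ → derivWeight n u = 4 := by
  decide +kernel

/-- These are the functions of odd weight. If the rarer value is taken at a single point, all
derivative weights are 2. If it is taken at three points a, b, c, the weight is 2 exactly along
their differences, and w = a + b + c, p = a, q = b serve. -/
theorem derivWeight_odd : ∀ n < 256, (∀ u < 8, u ≠ 0 → derivWeight n u % 4 = 2) →
    ∃ w < 8, ∃ p < 8, n.testBit w ≠ n.testBit p ∧ derivWeight n (w ^^^ p) = 2 ∧
      ∃ q < 8, n.testBit w ≠ n.testBit q ∧ p ≠ q ∧ derivWeight n (w ^^^ q) = 2 ∧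
        derivWeight n (p ^^^ q) = 2 := by
  decide +kernel

theorem bool_derivative_mod_four (b : (Fin 3 → ZMod 2) → Bool) :
    (∀ u, u ≠ 0 → #{x | b x ≠ b (x + u)} % 4 = 0) ∨
      (∀ u, u ≠ 0 → #{x | b x ≠ b (x + u)} % 4 = 2) := by
  obtain ⟨n, hn, -, hw⟩ := exists_encoding b
  simp_rw [hw]
  exact (derivWeight_mod_four n hn).imp
    (fun h u hu => h _ (cubeIndex_lt u) (cubeIndex_ne_zero hu))
    (fun h u hu => h _ (cubeIndex_lt u) (cubeIndex_ne_zero hu))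

theorem forall_cubeIndex {P : ℕ → Prop} (h : ∀ u, u ≠ 0 → P (cubeIndex u)) :
    ∀ i < 8, i ≠ 0 → P i := by
  intro i hi hi0
  obtain ⟨u, rfl⟩ := exists_cubeIndex_eq hi
  exact h u (by rintro rfl; exact hi0 (by decide))

theorem bool_derivative_even (b : (Fin 3 → ZMod 2) → Bool)
    (h : ∀ u, u ≠ 0 → #{x | b x ≠ b (x + u)} % 4 = 0) :
    (∀ u, u ≠ 0 → #{x | b x ≠ b (x + u)} ≠ 4) ∨
      ∃ u₀, u₀ ≠ 0 ∧ #{x | b x ≠ b (x + u₀)} ≠ 4 ∧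
        ∀ u, u ≠ 0 → u ≠ u₀ → #{x | b x ≠ b (x + u)} = 4 := by
  obtain ⟨n, hn, -, hw⟩ := exists_encoding b
  simp_rw [hw] at h ⊢
  rcases derivWeight_even n hn (forall_cubeIndex h) with h1 | ⟨i, hi, hi0, h4, h1⟩
  · exact .inl fun u hu => h1 _ (cubeIndex_lt u) (cubeIndex_ne_zero hu)
  · obtain ⟨u₀, rfl⟩ := exists_cubeIndex_eq hi
    exact .inr ⟨u₀, by rintro rfl; exact hi0 (by decide), h4, fun u hu hne =>
      h1 _ (cubeIndex_lt u) (cubeIndex_ne_zero hu) fun he => hne (cubeIndex_injective he)⟩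

theorem bool_derivative_odd (b : (Fin 3 → ZMod 2) → Bool)
    (h : ∀ u, u ≠ 0 → #{x | b x ≠ b (x + u)} % 4 = 2) :
    ∃ w p, b w ≠ b p ∧ #{x | b x ≠ b (x + (w + p))} = 2 ∧
      ∃ q, b w ≠ b q ∧ p ≠ q ∧ #{x | b x ≠ b (x + (w + q))} = 2 ∧
        #{x | b x ≠ b (x + (p + q))} = 2 := by
  obtain ⟨n, hn, hb, hw⟩ := exists_encoding b
  simp_rw [hw, hb, cubeIndex_add] at h ⊢
  obtain ⟨w, hw, p, hp, h1, h2, q, hq, h3, h4, h5, h6⟩ :=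
    derivWeight_odd n hn (forall_cubeIndex h)
  obtain ⟨w, rfl⟩ := exists_cubeIndex_eq hw
  obtain ⟨p, rfl⟩ := exists_cubeIndex_eq hp
  obtain ⟨q, rfl⟩ := exists_cubeIndex_eq hq
  exact ⟨w, p, h1, h2, q, h3, fun h => h4 (h ▸ rfl), h5, h6⟩

/-! ### Kinds of directions and their incompatibility -/

theorem exists_complement : ∀ u : Fin 3 → ZMod 2, u ≠ 0 → ∃ v w, v ≠ 0 ∧ w ≠ 0 ∧ v + w ≠ 0 ∧
  v ≠ u ∧ w ≠ u ∧ v + w ≠ u ∧ ∀ d,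
    d = 0 ∨ d = u ∨ d = v ∨ d = u + v ∨ d = w ∨ d = w + u ∨ d = w + v ∨ d = w + u + v := by
  decide +kernel

theorem cube_add_self (x : Fin 3 → ZMod 2) : x + x = 0 := by
  funext i; exact CharTwo.add_self_eq_zero _

theorem cube_add_cancel (x u : Fin 3 → ZMod 2) : x + u + u = x := by
  rw [add_assoc, cube_add_self, add_zero]

theorem cube_add_cancel_left (x y : Fin 3 → ZMod 2) : x + (x + y) = y := by
  rw [← add_assoc, cube_add_self, zero_add]

/-- Autocorrelation at `u` vanishes by cancellation of opposite terms. -/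
def IsCancelling {Q : Type*} [AddCommGroup Q] [DecidableEq Q] (ε : (Fin 3 → ZMod 2) → ℤ)
    (f : (Fin 3 → ZMod 2) → Q) (u : Fin 3 → ZMod 2) : Prop :=
  ∀ r, ∑ x, (if f x - f (x + u) = r then ε x * ε (x + u) else 0) = 0

/-- The signs are constant along `u`, exactly one pair is separated by `f`, it is not separated by
`g`, and some pair is separated by `g`. -/
def IsConstantSign {Q H : Type*} [DecidableEq Q] (ε : (Fin 3 → ZMod 2) → ℤ)
    (f : (Fin 3 → ZMod 2) → Q) (g : (Fin 3 → ZMod 2) → H) (u : Fin 3 → ZMod 2) : Prop :=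
  (∃ θ, ∀ x, ε x * ε (x + u) = θ) ∧ #{x | f x ≠ f (x + u)} = 2 ∧
    (∀ x, f x ≠ f (x + u) → g x = g (x + u)) ∧ ∃ x, g x ≠ g (x + u)

/-- The sign along `u` is determined by whether `f` separates the pair. -/
def IsCorrelated {Q : Type*} [AddCommGroup Q] [DecidableEq Q] (ε : (Fin 3 → ZMod 2) → ℤ)
    (f : (Fin 3 → ZMod 2) → Q) (u : Fin 3 → ZMod 2) : Prop :=
  (∃ θ, (θ = 1 ∨ θ = -1) ∧ ∀ x, ε x * ε (x + u) = if f x ≠ f (x + u) then -θ else θ) ∧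
    (∀ x, 3 • (f x - f (x + u)) = 0) ∧
    (#{x | f x ≠ f (x + u)} = 2 ∨ #{x | f x ≠ f (x + u)} = 6)

theorem sum_sign_ite {ι : Type*} [Fintype ι] (p : ι → Prop) [DecidablePred p] (θ : ℤ) :
    ∑ x, (if p x then -θ else θ) = θ * (Fintype.card ι - 2 * #{x | p x}) := by
  have : ∀ x, (if p x then -θ else θ) = θ - 2 * θ * (if p x then 1 else 0) := fun x => by
    split_ifs <;> ring
  simp_rw [this, sum_sub_distrib, ← mul_sum, sum_boole]
  simp
  ring

section
variable {ε : (Fin 3 → ZMod 2) → ℤ}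

theorem sum_mul_shift (hε : ∀ x, ε x = 1 ∨ ε x = -1) (u : Fin 3 → ZMod 2) :
    ∑ x, ε x * ε (x + u) =
      8 - 2 * #{x | decide (ε x = 1) ≠ decide (ε (x + u) = 1)} := by
  have : ∀ x, ε x * ε (x + u) = if decide (ε x = 1) ≠ decide (ε (x + u) = 1) then -1 else 1 := by
    intro x
    rcases hε x with h | h <;> rcases hε (x + u) with h' | h' <;> simp [h, h']
  simp_rw [this]
  rw [sum_sign_ite]
  simp

theorem IsCancelling.sum_eq {Q : Type*} [AddCommGroup Q] [DecidableEq Q] [Fintype Q]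
    {f : (Fin 3 → ZMod 2) → Q} {u : Fin 3 → ZMod 2}
    (h : IsCancelling ε f u) : ∑ x, ε x * ε (x + u) = 0 := by
  have : ∑ r, ∑ x, (if f x - f (x + u) = r then ε x * ε (x + u) else 0) = 0 :=
    sum_eq_zero fun r _ => h r
  rw [sum_comm] at this
  simpa using this

theorem IsConstantSign.not_cancelling {Q H : Type*} [AddCommGroup Q] [DecidableEq Q] [Fintype Q]
    {f : (Fin 3 → ZMod 2) → Q} {g : (Fin 3 → ZMod 2) → H} {u : Fin 3 → ZMod 2}
    (hε : ∀ x, ε x = 1 ∨ ε x = -1) (h : IsConstantSign ε f g u) :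
    ∑ x, ε x * ε (x + u) = 8 ∨ ∑ x, ε x * ε (x + u) = -8 := by
  obtain ⟨⟨θ, hθ⟩, -⟩ := h
  simp_rw [hθ]
  have := hθ 0
  simp
  rcases hε 0 with h | h <;> rcases hε (0 + u) with h' | h' <;> rw [h, h'] at this <;> omega

theorem IsCorrelated.sum_eq {Q : Type*} [AddCommGroup Q] [DecidableEq Q]
    {f : (Fin 3 → ZMod 2) → Q} {u : Fin 3 → ZMod 2} (h : IsCorrelated ε f u) :
    ∑ x, ε x * ε (x + u) = 4 ∨ ∑ x, ε x * ε (x + u) = -4 := by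
  obtain ⟨⟨θ, hθ, hx⟩, -, hc⟩ := h
  simp_rw [hx]
  rw [sum_sign_ite]
  simp
  rcases hc with hc | hc <;> rcases hθ with rfl | rfl <;> rw [hc] <;> norm_num

/-- If all directions are correlated with `f`, then `f` takes at most two values. -/
theorem correlated_two_values {Q : Type*} [AddCommGroup Q] [DecidableEq Q]
    {f : (Fin 3 → ZMod 2) → Q}
    (ht : ∃ t : Q, ∀ d, 3 • d = 0 → d = 0 ∨ d = t ∨ d = -t)
    (h : ∀ u, u ≠ 0 → IsCorrelated ε f u) (x y z : Fin 3 → ZMod 2) :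
    f x = f y ∨ f y = f z ∨ f x = f z := by
  by_contra! hne
  obtain ⟨hxy, hyz, hxz⟩ := hne
  -- Parallel pairs have equal sign products exactly when `f` separates both or neither.
  have key : ∀ a b c d, a + b = c + d → f a ≠ f b →
      (ε a * ε b * (ε c * ε d) = 1 ↔ f c ≠ f d) := by
    intro a b c d hs hab
    have hu : a + b ≠ 0 := fun h0 => hab <| congrArg f <| by
      rw [← cube_add_cancel_left b a, add_comm b a, h0, add_zero]
    obtain ⟨⟨θ, hθ, hx⟩, -⟩ := h _ hu
    have h1 := hx a
    have h2 := hx c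
    rw [cube_add_cancel_left] at h1
    rw [hs, cube_add_cancel_left] at h2
    rw [h1, h2, if_pos hab]
    rcases hθ with rfl | rfl <;> split_ifs with h3 <;> simp [h3]
  have hw : ∀ a b : Fin 3 → ZMod 2, a + b = z + (a + b + z) := fun a b => by
    rw [add_comm (a + b) z, cube_add_cancel_left]
  have e1 := key x y z (x + y + z) (hw x y) hxy
  have e2 := key x z y (x + y + z)
    (by rw [add_right_comm, add_comm _ y, cube_add_cancel_left]) hxz
  have e3 := key y z x (x + y + z) (by rw [add_assoc, cube_add_cancel_left]) hyz
  -- The three ways of pairing x, y, z, w give the same product of four signs, so w is separated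
  -- from all of x, y, z or from none. The latter would identify f y with f z; the former gives four
  -- values where the 3-torsion has room for three.
  set w := x + y + z with hw
  have e12 : ε x * ε z * (ε y * ε w) = ε x * ε y * (ε z * ε w) := by ring
  have e13 : ε y * ε z * (ε x * ε w) = ε x * ε y * (ε z * ε w) := by ring
  rw [e12, e1] at e2
  rw [e13, e1] at e3
  have hzw : f z ≠ f w := fun h0 => by
    have h1 : f y = f w := by
      by_contra h; exact e2.2 h h0
    exact hyz (h1.trans h0.symm)
  have hyw := e2.1 hzw
  have hxw := e3.1 hzw
  obtain ⟨t, ht⟩ := ht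
  have hval : ∀ b, f x ≠ f b → f x - f b = t ∨ f x - f b = -t := by
    intro b hb
    have hu : x + b ≠ 0 := fun h0 => hb <| congrArg f <| by
      rw [← cube_add_cancel_left b x, add_comm b x, h0, add_zero]
    have := (h _ hu).2.1 x
    rw [cube_add_cancel_left] at this
    exact (ht _ this).resolve_left (sub_ne_zero.2 hb)
  have hcan : ∀ b c, f x - f b = f x - f c → f b = f c := fun b c h => sub_right_injective h
  rcases hval y hxy with h1 | h1 <;> rcases hval z hxz with h2 | h2 <;>
    rcases hval w hxw with h3 | h3
  · exact hyz (hcan _ _ (h1.trans h2.symm))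
  · exact hyz (hcan _ _ (h1.trans h2.symm))
  · exact hyw (hcan _ _ (h1.trans h3.symm))
  · exact hzw (hcan _ _ (h2.trans h3.symm))
  · exact hzw (hcan _ _ (h2.trans h3.symm))
  · exact hyw (hcan _ _ (h1.trans h3.symm))
  · exact hyz (hcan _ _ (h1.trans h2.symm))
  · exact hyz (hcan _ _ (h1.trans h2.symm))

/-- Since `f` takes two values, its level set is a Boolean function of odd weight. On a triangle w,
p, q of directions of weight 2, `f` separates w from p and q, which makes g p = g w = g q; but f p =
f q forces g p ≠ g q. -/
theorem not_all_correlated {Q H : Type*} [AddCommGroup Q] [DecidableEq Q]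
    {f : (Fin 3 → ZMod 2) → Q} {g : (Fin 3 → ZMod 2) → H}
    (ht : ∃ t : Q, ∀ d, 3 • d = 0 → d = 0 ∨ d = t ∨ d = -t)
    (h : ∀ u, u ≠ 0 → IsCorrelated ε f u)
    (hg : ∀ u, u ≠ 0 → #{x | f x ≠ f (x + u)} = 2 → ∀ x, f x ≠ f (x + u) ↔ g x = g (x + u)) :
    False := by
  have h2 := correlated_two_values ht h
  let S : (Fin 3 → ZMod 2) → Bool := fun x => decide (f x = f 0)
  have hS : ∀ x y, S x ≠ S y ↔ f x ≠ f y := by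
    intro x y
    simp only [S, ne_eq, decide_eq_decide]
    constructor
    · exact fun hn he => hn (by rw [he])
    · intro hn he
      rcases h2 x y 0 with h | h | h
      · exact hn h
      · exact hn ((he.2 h).trans h.symm)
      · exact hn (h.trans (he.1 h).symm)
  have hcard : ∀ u, #{x | S x ≠ S (x + u)} = #{x | f x ≠ f (x + u)} := fun u => by
    simp_rw [hS]
  obtain ⟨w, p, hwp, hcwp, q, hwq, hpq, hcwq, hcpq⟩ := bool_derivative_odd S fun u hu => by
    rw [hcard]
    rcases (h u hu).2.2 with h | h <;> rw [h]
  rw [hcard] at hcwp hcwq hcpq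
  have hne : ∀ a b : Fin 3 → ZMod 2, a ≠ b → a + b ≠ 0 := fun a b hab h0 => hab <| by
    rw [← cube_add_cancel_left b a, add_comm b a, h0, add_zero]
  have g1 := hg _ (hne w p fun h => hwp (by rw [h])) hcwp w
  have g2 := hg _ (hne w q fun h => hwq (by rw [h])) hcwq w
  have g3 := hg _ (hne p q hpq) hcpq p
  rw [cube_add_cancel_left, ← hS] at g1 g2 g3
  have : S p = S q := by
    revert hwp hwq
    generalize S w = a, S p = b, S q = c
    revert a b c
    decide
  exact g3.2 ((g1.1 hwp).symm.trans (g2.1 hwq)) this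

/-- Seven directions give 14 separated ordered pairs among 8 points, so some point x is separated by
`f` from at most one other, x + u₀. Then `f` is constant except at x + u₀, which is separated from
every other point; so `g` is constant, against the last clause of the hypothesis. -/
theorem not_all_constantSign {Q H : Type*} [DecidableEq Q]
    {f : (Fin 3 → ZMod 2) → Q} {g : (Fin 3 → ZMod 2) → H}
    (h : ∀ u, u ≠ 0 → IsConstantSign ε f g u) : False := by
  have htot : ∑ x, #{u | f x ≠ f (x + u)} = 14 := by
    simp_rw [card_filter]
    rw [sum_comm]
    simp_rw [← card_filter]
    rw [← add_sum_erase _ _ (mem_univ (0 : Fin 3 → ZMod 2))]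
    rw [sum_congr rfl fun u hu => (h u (ne_of_mem_erase hu)).2.1]
    simp
  obtain ⟨x, hx⟩ : ∃ x, #{u | f x ≠ f (x + u)} ≤ 1 := by
    by_contra! hlt
    have : ∑ x : Fin 3 → ZMod 2, 2 ≤ ∑ x, #{u | f x ≠ f (x + u)} := sum_le_sum fun x _ => hlt x
    rw [htot] at this
    simp at this
  obtain ⟨u₀, hu₀⟩ : ∃ u, f x ≠ f (x + u) := by
    by_contra! hall
    have h1 : ∀ y, f y = f x := fun y => by
      rw [hall (x + y), cube_add_cancel_left]
    have h2 : (1 : Fin 3 → ZMod 2) ≠ 0 := by decide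
    have := (h 1 h2).2.1
    simp [h1] at this
  have huniq : ∀ u, f x ≠ f (x + u) → u = u₀ := fun u hu =>
    card_le_one.1 hx u (by simpa using hu) u₀ (by simpa using hu₀)
  have hg : ∀ v, g (x + u₀ + v) = g (x + u₀) := by
    intro v
    rcases eq_or_ne v 0 with rfl | hv
    · rw [add_zero]
    refine ((h v hv).2.2.1 (x + u₀) fun he => ?_).symm
    have : f x = f (x + u₀ + v) := by
      by_contra hne
      have h1 := huniq (u₀ + v) (by rwa [← add_assoc])
      exact hv (add_eq_left.1 h1)
    exact hu₀ (this.trans he.symm)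
  have hg' : ∀ y, g y = g (x + u₀) := fun y => by
    rw [← hg (x + u₀ + y), cube_add_cancel_left]
  obtain ⟨y, hy⟩ := (h 1 (by decide)).2.2.2
  exact hy (by rw [hg' y, hg' (y + 1)])

/-- A cancelling direction `v` next to a constant-sign direction `u`. -/
theorem IsCancelling.midpoint {Q : Type*} [AddCommGroup Q] [DecidableEq Q]
    {f : (Fin 3 → ZMod 2) → Q} (hε : ∀ x, ε x = 1 ∨ ε x = -1) {u v w : Fin 3 → ZMod 2}
    {θ : ℤ} (hu : ∀ x, ε x * ε (x + u) = θ) {x : Fin 3 → ZMod 2} (hfx : f x ≠ f (x + u))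
    (hv : IsCancelling ε f v)
    (hspan : ∀ d, d = 0 ∨ d = u ∨ d = v ∨ d = u + v ∨ d = w ∨ d = w + u ∨ d = w + v ∨
      d = w + u + v)
    (hfv : f (x + u + v) = f (x + v)) (hfw : f (x + w + u) = f (x + w))
    (hfwv : f (x + w + u + v) = f (x + w + v)) :
    f (x + w) ≠ f (x + w + v) ∧ f x + f (x + u) = f (x + v) + f (x + v) := by
  have hsq : ∀ y, ε y * ε y = 1 := fun y => by rcases hε y with h | h <;> rw [h] <;> norm_num
  have hperu : ∀ y, ε (y + u) * ε (y + u + v) = ε y * ε (y + v) := by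
    intro y
    have h1 := hu y
    have h2 := hu (y + v)
    rw [add_right_comm] at h2
    have h3 : ε (y + u) = θ * ε y := by rw [← h1, mul_right_comm, hsq, one_mul]
    have h4 : ε (y + u + v) = θ * ε (y + v) := by rw [← h2, mul_right_comm, hsq, one_mul]
    have h5 : θ * θ = 1 := by
      rw [← h1]
      rcases hε y with h | h <;> rcases hε (y + u) with h' | h' <;> rw [h, h'] <;> norm_num
    rw [h3, h4, mul_mul_mul_comm, h5, one_mul]
  have hperv : ∀ y, ε (y + v) * ε (y + v + v) = ε y * ε (y + v) := fun y => by
    rw [cube_add_cancel, mul_comm]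
  -- The sign along v is constant on the coset of x modulo u, v. The term at y can therefore cancel
  -- only against the other coset, where the differences are plus or minus a single value.
  have key : ∀ y, y = x ∨ y = x + u →
      f y - f (x + v) = f (x + w) - f (x + w + v) ∨
        f y - f (x + v) = f (x + w + v) - f (x + w) := by
    intro y hy
    have hfy : f (y + v) = f (x + v) := by rcases hy with rfl | rfl <;> simp [hfv]
    have hεy : ε y * ε (y + v) = ε x * ε (x + v) := by
      rcases hy with rfl | rfl
      · rfl
      · exact hperu x
    have hs := hv (f y - f (y + v))
    by_contra hcon
    push Not at hcon
    have hall : ∀ d, f d - f (d + v) = f y - f (y + v) → ε d * ε (d + v) = ε x * ε (x + v) := by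
      intro d hd
      rw [hfy] at hd
      rcases hspan (x + d) with h | h | h | h | h | h | h | h <;>
        (have hd' := cube_add_cancel_left x d; rw [h] at hd'; try simp only [← add_assoc] at hd';
         subst hd')
      · simp
      · exact hperu x
      · exact hperv x
      · rw [hperv, hperu]
      · exact absurd hd.symm hcon.1
      · rw [hfw, hfwv] at hd; exact absurd hd.symm hcon.1
      · rw [cube_add_cancel] at hd; exact absurd hd.symm hcon.2
      · rw [cube_add_cancel, hfwv, hfw] at hd; exact absurd hd.symm hcon.2
    have h1 : ∀ d, (if f d - f (d + v) = f y - f (y + v) then ε d * ε (d + v) else 0) =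
        ε x * ε (x + v) * (if f d - f (d + v) = f y - f (y + v) then 1 else 0) := by
      intro d
      split_ifs with hd
      · rw [hall d hd, mul_one]
      · rw [mul_zero]
    simp_rw [h1, ← mul_sum] at hs
    rcases mul_eq_zero.1 hs with h2 | h2
    · rcases hε x with h | h <;> rcases hε (x + v) with h' | h' <;> rw [h, h'] at h2 <;> omega
    · rw [sum_boole] at h2
      have : y ∈ ({d | f d - f (d + v) = f y - f (y + v)} : Finset (Fin 3 → ZMod 2)) := by simp
      have := card_pos.2 ⟨y, this⟩
      omega
  have k1 := key x (.inl rfl)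
  have k2 := key (x + u) (.inr rfl)
  have hopp : f x - f (x + v) = -(f (x + u) - f (x + v)) := by
    rcases k1 with k1 | k1 <;> rcases k2 with k2 | k2
    · exact absurd (sub_left_injective (k1.trans k2.symm)) hfx
    · rw [k1, k2, neg_sub]
    · rw [k1, k2, neg_sub]
    · exact absurd (sub_left_injective (k1.trans k2.symm)) hfx
  refine ⟨fun he => ?_, ?_⟩
  · rw [he, sub_self, or_self] at k1 k2
    exact hfx (sub_left_injective (k1.trans k2.symm))
  · rw [neg_sub, sub_eq_sub_iff_add_eq_add] at hopp
    exact hopp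

end

/-- The derivative of ε has weight 4, 0 or 8, or 2 or 6 according to the kind of direction, so
either all directions are correlated or none is. With none, either all have constant sign, or
exactly one does and the others cancel; the latter case falls to `IsCancelling.midpoint`. -/
theorem no_cube_configuration {Q H : Type*} [AddCommGroup Q] [DecidableEq Q] [Fintype Q]
    {ε : (Fin 3 → ZMod 2) → ℤ}
    {f : (Fin 3 → ZMod 2) → Q} {g : (Fin 3 → ZMod 2) → H} (hε : ∀ x, ε x = 1 ∨ ε x = -1)
    (hQ : ∀ a : Q, 2 • a = 0 → a = 0)
    (ht : ∃ t : Q, ∀ d, 3 • d = 0 → d = 0 ∨ d = t ∨ d = -t)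
    (h : ∀ u, u ≠ 0 → IsCancelling ε f u ∨ IsConstantSign ε f g u ∨ (IsCorrelated ε f u ∧
      (#{x | f x ≠ f (x + u)} = 2 → ∀ x, f x ≠ f (x + u) ↔ g x = g (x + u)))) : False := by
  have hA : ∀ u, IsCancelling ε f u →
      #{x | decide (ε x = 1) ≠ decide (ε (x + u) = 1)} = 4 := fun u hu => by
    have h1 := hu.sum_eq
    rw [sum_mul_shift hε] at h1
    omega
  have hB : ∀ u, IsConstantSign ε f g u →
      #{x | decide (ε x = 1) ≠ decide (ε (x + u) = 1)} = 0 ∨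
        #{x | decide (ε x = 1) ≠ decide (ε (x + u) = 1)} = 8 := fun u hu => by
    have h1 := hu.not_cancelling hε
    rw [sum_mul_shift hε] at h1
    omega
  have hC : ∀ u, IsCorrelated ε f u →
      #{x | decide (ε x = 1) ≠ decide (ε (x + u) = 1)} % 4 = 2 := fun u hu => by
    have h1 := hu.sum_eq
    rw [sum_mul_shift hε] at h1
    omega
  rcases bool_derivative_mod_four (fun x => decide (ε x = 1)) with hmod | hmod
  · have hAB : ∀ u, u ≠ 0 → IsCancelling ε f u ∨ IsConstantSign ε f g u := by
      intro u hu
      rcases h u hu with h1 | h1 | h1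
      · exact .inl h1
      · exact .inr h1
      · have := hC u h1.1
        have := hmod u hu
        omega
    rcases bool_derivative_even (fun x => decide (ε x = 1)) hmod with h4 | ⟨u, hu0, hu, h4⟩
    · exact not_all_constantSign fun u hu => (hAB u hu).resolve_left fun hc => h4 u hu (hA u hc)
    · have huB : IsConstantSign ε f g u := (hAB u hu0).resolve_left fun hc => hu (hA u hc)
      have hothers : ∀ v, v ≠ 0 → v ≠ u → IsCancelling ε f v := fun v hv0 hvu =>
        (hAB v hv0).resolve_right fun hc => by
          have := hB v hc
          have := h4 v hv0 hvu
          omega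
      obtain ⟨⟨θ, hθ⟩, hcard, -⟩ := huB
      obtain ⟨x, hx⟩ : ∃ x, f x ≠ f (x + u) := by
        by_contra! hall
        simp [← hall] at hcard
      have heq : ∀ y, y ≠ x → y ≠ x + u → f (y + u) = f y := by
        intro y hy1 hy2
        by_contra hne
        have hsub : ({x, x + u, y} : Finset (Fin 3 → ZMod 2)) ⊆
            ({x | f x ≠ f (x + u)} : Finset (Fin 3 → ZMod 2)) := by
          intro z hz
          simp only [mem_insert, mem_singleton] at hz
          simp only [mem_filter, mem_univ, true_and]
          rcases hz with rfl | rfl | rfl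
          · exact hx
          · rw [cube_add_cancel]; exact hx.symm
          · exact Ne.symm hne
        have := card_le_card hsub
        rw [hcard, card_insert_of_notMem, card_pair hy2.symm] at this
        · omega
        · simp [hy1.symm, hu0]
      obtain ⟨v, w, hv0, hw0, hvw0, hvu, hwu, hvwu, hspan⟩ := exists_complement u hu0
      have heq' : ∀ d, d ≠ 0 → d ≠ u → f (x + d + u) = f (x + d) := fun d hd0 hdu =>
        heq _ (by simpa using hd0) (by simpa using hdu)
      have ev := heq' v hv0 hvu
      have ew := heq' w hw0 hwu
      have evw := heq' (v + w) hvw0 hvwu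
      have hwv : x + (v + w) = x + w + v := by abel
      have hvw : x + (v + w) = x + v + w := by abel
      have m1 := (hothers v hv0 hvu).midpoint hε hθ hx hspan
        (by rw [add_right_comm]; exact ev) ew (by rw [add_right_comm, ← hwv]; exact evw)
      have m2 := (hothers w hw0 hwu).midpoint (w := v) hε hθ hx
        (fun d => by
          have := hspan d
          rw [add_comm w u, add_comm w v, add_right_comm u w v] at this
          rw [add_comm v u]
          tauto)
        (by rw [add_right_comm]; exact ew) ev (by rw [add_right_comm, ← hvw]; exact evw)
      have m3 := (hothers (v + w) hvw0 hvwu).midpoint (w := v) hε hθ hx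
        (fun d => by
          have h1 : v + (v + w) = w := cube_add_cancel_left v w
          have h2 : v + u + (v + w) = w + u := by
            rw [add_right_comm, h1]
          have h3 := hspan d
          rw [h1, h2]
          have h4 : w + v = v + w := add_comm _ _
          have h5 : w + u + v = u + (v + w) := by abel
          rw [h4, h5] at h3
          rw [add_comm v u]
          tauto)
        (by rw [add_right_comm]; exact evw) ev (by
          have h1 : x + v + (v + w) = x + w := by rw [add_assoc, cube_add_cancel_left]
          rw [add_right_comm, h1]; exact ew)
      have h1 : x + v + (v + w) = x + w := by rw [add_assoc, cube_add_cancel_left]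
      rw [h1] at m3
      -- f(x + v) and f(x + w) are both midpoints of f x and f(x + u), hence equal in the absence of
      -- 2-torsion, while the direction v + w requires them to differ.
      refine m3.1 (sub_eq_zero.1 (hQ _ ?_))
      rw [smul_sub, two_nsmul, two_nsmul, ← m1.2, ← m2.2, sub_self]
  · have hCD : ∀ u, u ≠ 0 → (IsCorrelated ε f u ∧
      (#{x | f x ≠ f (x + u)} = 2 → ∀ x, f x ≠ f (x + u) ↔ g x = g (x + u))) := by
      intro u hu
      have h2 := hmod u hu
      rcases h u hu with h1 | h1 | h1
      · have := hA u h1; omega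
      · have := hB u h1; omega
      · exact h1
    exact not_all_correlated ht (fun u hu => (hCD u hu).1) fun u hu => (hCD u hu).2

/-! ### From bent functions to signed roots of unity -/

theorem neg_one_pow_val_add (a b : ZMod 2) :
    (-1 : ℂ) ^ (a + b).val = (-1) ^ a.val * (-1) ^ b.val := by
  have : ∀ a b : ZMod 2, (-1 : ℤ) ^ (a + b).val = (-1) ^ a.val * (-1) ^ b.val := by decide
  exact_mod_cast congrArg (Int.cast : ℤ → ℂ) (this a b)

theorem sum_cube_character (d : Fin 3 → ZMod 2) :
    ∑ y : Fin 3 → ZMod 2, (-1 : ℂ) ^ (∑ i, y i * d i : ZMod 2).val = if d = 0 then 8 else 0 := by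
  have : ∀ d : Fin 3 → ZMod 2, ∑ y : Fin 3 → ZMod 2, (-1 : ℤ) ^ (∑ i, y i * d i : ZMod 2).val =
      if d = 0 then 8 else 0 := by decide +kernel
  have h := congrArg (Int.cast : ℤ → ℂ) (this d)
  push_cast at h
  exact h

theorem cube_add_eq_zero_iff {x y : Fin 3 → ZMod 2} : x + y = 0 ↔ y = x := by
  constructor
  · intro h; rw [← cube_add_cancel_left x y, h, add_zero]
  · rintro rfl; exact cube_add_self _

/-- The autocorrelations of a generalized bent function vanish. -/
theorem IsGeneralizedBent.autocorrelation {m : ℕ} {f : (Fin 3 → ZMod 2) → ZMod m}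
    (hf : IsGeneralizedBent m 3 f) {u : Fin 3 → ZMod 2} (hu : u ≠ 0) :
    ∑ x, zetaRoot m ^ (f x).val * (starRingEnd ℂ) (zetaRoot m ^ (f (x + u)).val) = 0 := by
  set G : (Fin 3 → ZMod 2) → ℂ := fun x => zetaRoot m ^ (f x).val with hG
  set χ : (Fin 3 → ZMod 2) → (Fin 3 → ZMod 2) → ℂ :=
    fun y x => (-1) ^ (∑ i, y i * x i : ZMod 2).val with hχ
  have hχadd : ∀ y a b, χ y (a + b) = χ y a * χ y b := fun y a b => by
    simp only [hχ]
    rw [← neg_one_pow_val_add, ← sum_add_distrib]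
    simp [mul_add]
  have hχconj : ∀ y a, (starRingEnd ℂ) (χ y a) = χ y a := fun y a => by simp [hχ]
  have hF : ∀ y, (∑ x, G x * χ y x) * (∑ x, (starRingEnd ℂ) (G x) * χ y x) = 8 := by
    intro y
    have h1 := hf y
    have h2 : ∑ x, (starRingEnd ℂ) (G x) * χ y x = (starRingEnd ℂ) (gbfTransform m 3 f y) := by
      rw [gbfTransform, map_sum]
      refine sum_congr rfl fun x _ => ?_
      rw [map_mul]
      congr 1
      exact (hχconj y x).symm
    rw [h2]
    change gbfTransform m 3 f y * _ = 8
    rw [Complex.mul_conj, Complex.normSq_eq_norm_sq, h1]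
    norm_num
  -- Testing the constant |F|² = 8 against the character of u ≠ 0 gives 0; expanding the same sum
  -- gives 8 times the autocorrelation at u.
  have h1 : ∑ y, χ y u * ((∑ x, G x * χ y x) * (∑ x, (starRingEnd ℂ) (G x) * χ y x)) = 0 := by
    simp_rw [hF, ← sum_mul]
    rw [hχ, sum_cube_character, if_neg hu, zero_mul]
  have h2 : ∑ y, χ y u * ((∑ x, G x * χ y x) * (∑ x, (starRingEnd ℂ) (G x) * χ y x)) =
      ∑ x, ∑ x', G x * (starRingEnd ℂ) (G x') * ∑ y, χ y (x + u + x') := by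
    simp_rw [sum_mul_sum, mul_sum]
    rw [sum_comm]
    refine sum_congr rfl fun x _ => ?_
    rw [sum_comm]
    refine sum_congr rfl fun x' _ => sum_congr rfl fun y _ => ?_
    rw [hχadd, hχadd]
    ring
  rw [h2] at h1
  have h3 : ∀ x x', ∑ y, χ y (x + u + x') = if x' = x + u then 8 else 0 := fun x x' => by
    rw [hχ, sum_cube_character]
    simp_rw [cube_add_eq_zero_iff]
  simp_rw [h3, mul_ite, mul_zero] at h1
  simp only [sum_ite_eq', mem_univ, if_true, ← sum_mul] at h1
  exact (mul_eq_zero.1 h1).resolve_right (by norm_num)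

theorem exists_stdAddChar_eq {N : ℕ} [NeZero N] {z : ℂ} (hz : z ^ N = 1) :
    ∃ j : ZMod N, ZMod.stdAddChar j = z := by
  obtain ⟨i, -, hi⟩ := (Complex.isPrimitiveRoot_exp N (NeZero.ne N)).eq_pow_of_pow_eq_one hz
  refine ⟨((i : ℤ) : ZMod N), ?_⟩
  rw [ZMod.stdAddChar_coe, ← hi, ← Complex.exp_nat_mul]
  congr 1
  push_cast
  ring

theorem even_sum_of_shift {F : (Fin 3 → ZMod 2) → ℤ} {u : Fin 3 → ZMod 2} (hu : u ≠ 0)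
    (hF : ∀ x, F (x + u) = F x) : Even (∑ x, F x) := by
  rw [← ZMod.intCast_eq_zero_iff_even, Int.cast_sum]
  refine sum_involution (fun x _ => x + u) (fun x _ => ?_) (fun x _ _ h => hu (add_eq_left.1 h))
    (fun _ _ => mem_univ _) (fun x _ => cube_add_cancel x u)
  rw [hF]; exact CharTwo.add_self_eq_zero _

/-- Counting data for the signed differences in the direction `u`. -/
theorem autocorrelation_classification {a q : ℕ} [NeZero q] (hq : q = 3 ^ (a + 1))
    {H : Type*} [AddCommGroup H] [Fintype H] [DecidableEq H]
    (hH2 : Nat.Coprime 2 (Fintype.card H)) (hH3 : Nat.Coprime 3 (Fintype.card H))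
    (hH : ShortSums H) (ψ : AddChar (ZMod q × H) ℂ) (hψ : Function.Injective ψ)
    {ε : (Fin 3 → ZMod 2) → ℤ} (hε : ∀ x, ε x = 1 ∨ ε x = -1)
    (k : (Fin 3 → ZMod 2) → ZMod q × H) {u : Fin 3 → ZMod 2} (hu : u ≠ 0)
    (h0 : ∑ x, ((ε x * ε (x + u) : ℤ) : ℂ) * ψ (k x - k (x + u)) = 0) :
    IsCancelling ε (fun x => (k x).1) u ∨
      IsConstantSign ε (fun x => (k x).1) (fun x => (k x).2) u ∨
      (IsCorrelated ε (fun x => (k x).1) u ∧ (#{x | (k x).1 ≠ (k (x + u)).1} = 2 →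
        ∀ x, (k x).1 ≠ (k (x + u)).1 ↔ (k x).2 = (k (x + u)).2)) := by
  set η : (Fin 3 → ZMod 2) → ℤ := fun x => ε x * ε (x + u) with hη
  have hη1 : ∀ x, η x = 1 ∨ η x = -1 := fun x => by
    rcases hε x with h | h <;> rcases hε (x + u) with h' | h' <;> simp [hη, h, h']
  have hηu : ∀ x, η (x + u) = η x := fun x => by
    simp only [hη]; rw [cube_add_cancel, mul_comm]
  set c : ZMod q × H → ℤ := fun v => ∑ x, if k x - k (x + u) = v then η x else 0 with hcdef
  have hF : ∀ F : ZMod q × H → ℤ, ∑ v, c v * F v = ∑ x, η x * F (k x - k (x + u)) := by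
    intro F
    simp_rw [hcdef, sum_mul, ite_mul, zero_mul]
    rw [sum_comm]
    simp
  have hFC : ∑ v, (c v : ℂ) * ψ v = 0 := by
    rw [← h0]
    simp_rw [hcdef, Int.cast_sum, sum_mul, Int.cast_ite, Int.cast_zero, ite_mul, zero_mul]
    rw [sum_comm]
    simp [hη]
  have hsymm : ∀ v, c (-v) = c v := by
    intro v
    simp only [hcdef]
    rw [← Equiv.sum_comp (Equiv.addRight u)]
    refine sum_congr rfl fun x _ => ?_
    have h1 : k (x + u) - k (x + u + u) = -(k x - k (x + u)) := by rw [cube_add_cancel, neg_sub]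
    simp only [Equiv.coe_addRight, hηu, h1, neg_inj]
  have heven : Even (c 0) := by
    refine even_sum_of_shift hu fun x => ?_
    have h1 : k (x + u) - k (x + u + u) = -(k x - k (x + u)) := by rw [cube_add_cancel, neg_sub]
    simp only [hηu, h1, neg_eq_zero]
  have h4 : 4 ∣ ∑ v, c v := by
    have h1 := hF 1
    simp only [Pi.one_apply, mul_one] at h1
    rw [h1]
    change 4 ∣ ∑ x, ε x * ε (x + u)
    rw [sum_mul_shift hε]
    rcases bool_derivative_mod_four (fun x => decide (ε x = 1)) with h | h <;>
    · have := h u hu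
      omega
  have hnorm : ∑ v, |c v| ≤ 8 := by
    have h1 : ∀ v, |c v| ≤ ∑ x, if k x - k (x + u) = v then 1 else 0 := fun v => by
      refine (abs_sum_le_sum_abs _ _).trans (sum_le_sum fun x _ => ?_)
      split_ifs
      · rcases hη1 x with h | h <;> simp [h]
      · simp
    refine (sum_le_sum fun v _ => h1 v).trans ?_
    rw [sum_comm]
    simp
  have hsub : ∀ x, (k x - k (x + u)).1 = (k x).1 - (k (x + u)).1 := fun x => rfl
  have hpair : ∀ x, k x - k (x + u) = ((k x).1 - (k (x + u)).1, (k x).2 - (k (x + u)).2) :=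
    fun x => rfl
  -- if the norm is maximal there is no cancellation
  have hsign : ∑ v, |c v| = 8 → ∀ x, η x * (c (k x - k (x + u))).sign = 1 := by
    intro h8
    have h1 : ∑ x, η x * (c (k x - k (x + u))).sign = ∑ x : Fin 3 → ZMod 2, (1 : ℤ) := by
      rw [← hF fun v => (c v).sign]
      simp_rw [Int.mul_sign_self, ← Int.abs_eq_natAbs]
      rw [h8]; simp
    refine fun x => (sum_eq_sum_iff_of_le fun x _ => ?_).1 h1 x (mem_univ x)
    have h2 := Int.sign_trichotomy (c (k x - k (x + u)))
    rcases hη1 x with h | h <;> rcases h2 with h2 | h2 | h2 <;> rw [h, h2] <;> norm_num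
  -- Without cancellation, the norm of the zero fibre counts the points not separated by the first
  -- component.
  have hcard : ∑ v, |c v| = 8 →
      (#{x | (k x).1 ≠ (k (x + u)).1} : ℤ) = 8 - ∑ h, |c (0, h)| := by
    intro h8
    have h1 := hF fun v => if v.1 = 0 then (c v).sign else 0
    simp_rw [mul_ite, mul_zero, Int.mul_sign_self, ← Int.abs_eq_natAbs, hsign h8] at h1
    rw [Fintype.sum_prod_type, Fintype.sum_eq_single 0 (fun r hr => by simp [hr]), sum_boole] at h1
    simp only [if_true] at h1
    rw [h1]
    have h2 := card_filter_add_card_filter_not (s := (univ : Finset (Fin 3 → ZMod 2)))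
      (fun x => (k x).1 = (k (x + u)).1)
    simp only [hsub, sub_eq_zero]
    simp at h2 ⊢
    omega
  have hcorr : IsSignSplit c →
      (#{x | (k x).1 ≠ (k (x + u)).1} = 2 ∨ #{x | (k x).1 ≠ (k (x + u)).1} = 6) →
      IsCorrelated ε (fun x => (k x).1) u := by
    rintro ⟨h8, hoff, θ, hθ, hpos, hneg⟩ h26
    refine ⟨⟨θ, hθ, fun x => ?_⟩, fun x => ?_, h26⟩
    · have h1 := hsign h8 x
      change η x = if (k x).1 ≠ (k (x + u)).1 then -θ else θ
      rw [hpair] at h1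
      split_ifs with hx
      · have h2 := hneg _ (sub_ne_zero.2 hx) ((k x).2 - (k (x + u)).2)
        rcases Int.sign_trichotomy (c ((k x).1 - (k (x + u)).1, (k x).2 - (k (x + u)).2))
          with h3 | h3 | h3 <;> rw [h3] at h1
        · rw [Int.sign_eq_one_iff_pos] at h3
          rcases hθ with rfl | rfl <;> omega
        · omega
        · rw [Int.sign_eq_neg_one_iff_neg] at h3
          rcases hθ with rfl | rfl <;> omega
      · have h2 := hpos ((k x).2 - (k (x + u)).2)
        rw [not_not] at hx
        rw [hx, sub_self] at h1
        rcases Int.sign_trichotomy (c (0, (k x).2 - (k (x + u)).2))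
          with h3 | h3 | h3 <;> rw [h3] at h1
        · rw [Int.sign_eq_one_iff_pos] at h3
          rcases hθ with rfl | rfl <;> omega
        · omega
        · rw [Int.sign_eq_neg_one_iff_neg] at h3
          rcases hθ with rfl | rfl <;> omega
    · by_contra h3
      have h1 := hsign h8 x
      rw [hpair, hoff _ h3] at h1
      simp at h1
  rcases vanishing_symm_classification hq hH2 hH3 hH ψ hψ c hsymm heven h4 hnorm hFC with
    hc | ⟨h8, h6, hz, ⟨h, hh, hch⟩, θ, hθ, hpos⟩ | ⟨hs, h6, hz, h00⟩ | ⟨hs, h2⟩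
  · left
    intro r
    have h1 := hF fun v => if v.1 = r then 1 else 0
    rw [hc] at h1
    simpa [hsub] using h1.symm
  · right; left
    refine ⟨⟨θ, fun x => ?_⟩, ?_, fun x hx => ?_, ?_⟩
    · have h1 := hsign h8 x
      have h2 := hpos (k x - k (x + u))
      change η x = _
      rcases Int.sign_trichotomy (c (k x - k (x + u))) with h3 | h3 | h3 <;> rw [h3] at h1
      · rw [Int.sign_eq_one_iff_pos] at h3
        rcases hθ with rfl | rfl <;> omega
      · omega
      · rw [Int.sign_eq_neg_one_iff_neg] at h3
        rcases hθ with rfl | rfl <;> omega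
    · have := hcard h8
      rw [h6] at this
      change #{x | (k x).1 ≠ (k (x + u)).1} = 2
      omega
    · by_contra hne
      have h1 := hsign h8 x
      rw [hpair, hz _ (sub_ne_zero.2 hx) _ (sub_ne_zero.2 hne)] at h1
      simp at h1
    · by_contra! hall
      refine hch (sum_eq_zero fun x _ => if_neg fun he => hh ?_)
      have := congrArg Prod.snd he
      rw [hpair, hall x, sub_self] at this
      exact this.symm
  · right; right
    have h2 : #{x | (k x).1 ≠ (k (x + u)).1} = 2 := by
      have := hcard hs.1; rw [h6] at this; omega
    refine ⟨hcorr hs (.inl h2), fun _ x => ⟨fun hx => ?_, fun hx hx' => ?_⟩⟩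
    · by_contra hne
      have h1 := hsign hs.1 x
      rw [hpair, hz _ (sub_ne_zero.2 hx) _ (sub_ne_zero.2 hne)] at h1
      simp at h1
    · have h1 := hsign hs.1 x
      rw [hpair, hx, hx', sub_self, sub_self, h00] at h1
      simp at h1
  · right; right
    have h6 : #{x | (k x).1 ≠ (k (x + u)).1} = 6 := by
      have := hcard hs.1; rw [h2] at this; omega
    exact ⟨hcorr hs (.inr h6), fun h => by omega⟩

theorem exists_odd_zetaRoot_pow {m : ℕ} (hm : 2 ≤ m) (hm' : Odd m ∨ m ≡ 2 [MOD 4]) :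
    ∃ N, Odd N ∧ zetaRoot m ^ (2 * N) = 1 := by
  have h1 : zetaRoot m ^ m = 1 := (Complex.isPrimitiveRoot_exp m (by omega)).pow_eq_one
  rcases hm' with h | h
  · exact ⟨m, h, by rw [mul_comm, pow_mul, h1, one_pow]⟩
  · have h2 : m % 4 = 2 := h
    refine ⟨m / 2, Nat.odd_iff.2 (by omega), ?_⟩
    rw [show 2 * (m / 2) = m by omega, h1]

theorem theorem4p4 (m : ℕ) (hm : 2 ≤ m) (hm' : Odd m ∨ m ≡ 2 [MOD 4]) :
    ¬ ∃ f : (Fin 3 → ZMod 2) → ZMod m, IsGeneralizedBent m 3 f := by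
  rintro ⟨f, hf⟩
  obtain ⟨N₀, hodd₀, hN₀⟩ := exists_odd_zetaRoot_pow hm hm'
  -- The factor 3 guarantees a nontrivial 3-part q = 3^(a+1), even when 3 does not divide m.
  obtain ⟨N, hN⟩ : ∃ N, N = 3 * N₀ := ⟨_, rfl⟩
  have hodd : Odd N := hN ▸ Odd.mul (by decide) hodd₀
  have hN0 : N ≠ 0 := by rintro rfl; exact absurd hodd (by decide)
  have hpow : zetaRoot m ^ (2 * N) = 1 := by
    rw [hN, show 2 * (3 * N₀) = 2 * N₀ * 3 by ring, pow_mul, hN₀, one_pow]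
  obtain ⟨e, M, hM, hNe⟩ := Nat.exists_eq_pow_mul_and_not_dvd hN0 3 (by norm_num)
  obtain _ | a := e
  · rw [pow_zero, one_mul] at hNe; exact absurd (hNe ▸ hN ▸ dvd_mul_right 3 N₀) hM
  obtain ⟨q, hq⟩ : ∃ q, q = 3 ^ (a + 1) := ⟨_, rfl⟩
  rw [← hq] at hNe
  have hM0 : M ≠ 0 := by rintro rfl; simp at hM
  have : NeZero M := ⟨hM0⟩
  have : NeZero q := ⟨by rw [hq]; positivity⟩
  have : NeZero (q * M) := ⟨hNe ▸ hN0⟩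
  have hM3 : Nat.Coprime 3 M := (Nat.Prime.coprime_iff_not_dvd Nat.prime_three).2 hM
  have hM2 : Nat.Coprime 2 M := by
    rw [hNe] at hodd
    exact Nat.coprime_two_left.2 (Nat.odd_mul.1 hodd).2
  have hcop : q.Coprime M := hq ▸ hM3.pow_left _
  let φ := ZMod.chineseRemainder hcop
  let ψ : AddChar (ZMod q × ZMod M) ℂ :=
    (ZMod.stdAddChar (N := q * M)).compAddMonoidHom φ.symm.toAddEquiv.toAddMonoidHom
  have hψ : Function.Injective ψ := ZMod.injective_stdAddChar.comp φ.symm.injective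
  have hdec : ∀ x, ∃ (ε : ℤ) (k : ZMod q × ZMod M), (ε = 1 ∨ ε = -1) ∧
      zetaRoot m ^ (f x).val = ε * ψ k := by
    intro x
    set z := zetaRoot m ^ (f x).val with hz
    have hzN : (z ^ N) ^ 2 = 1 := by
      rw [hz, ← pow_mul, ← pow_mul, mul_comm N, mul_comm, pow_mul, hpow, one_pow]
    have key : ∀ ε : ℤ, (ε = 1 ∨ ε = -1) → z ^ N = ε → ∃ (ε : ℤ) (k : ZMod q × ZMod M),
        (ε = 1 ∨ ε = -1) ∧ z = ε * ψ k := by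
      intro ε hε h
      -- As N is odd, multiplying z by the sign ε = z^N turns it into an N-th root of unity.
      have h1 : ((ε : ℂ) * z) ^ (q * M) = 1 := by
        rw [← hNe, mul_pow, h]
        rcases hε with rfl | rfl
        · simp
        · push_cast; rw [hodd.neg_one_pow]; norm_num
      obtain ⟨j, hj⟩ := exists_stdAddChar_eq h1
      refine ⟨ε, φ j, hε, ?_⟩
      have h2 : ψ (φ j) = ε * z := by
        rw [← hj]
        change ZMod.stdAddChar (φ.symm (φ j)) = _
        rw [RingEquiv.symm_apply_apply]
      rw [h2]
      rcases hε with rfl | rfl <;> simp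
    rcases (eq_or_eq_neg_of_sq_eq_sq _ _ (hzN.trans (one_pow 2).symm)) with h | h
    · exact key 1 (.inl rfl) (by simpa using h)
    · exact key (-1) (.inr rfl) (by simpa using h)
  choose ε k hε hk using hdec
  have hHcard : Fintype.card (ZMod M) = M := ZMod.card M
  refine no_cube_configuration (Q := ZMod q) (ε := ε) (f := fun x => (k x).1)
    (g := fun x => (k x).2) hε (fun a ha => ?_) ?_ fun u hu => ?_
  · refine eq_zero_of_coprime_nsmul ?_ ha
    rw [ZMod.card, hq]; exact Nat.Coprime.pow_right _ (by norm_num)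
  · obtain ⟨t, -, -, ht⟩ := exists_three_torsion hq
    exact ⟨t, fun d hd => by simpa using (Finset.ext_iff.1 ht d).1 (by simpa using hd)⟩
  · refine autocorrelation_classification hq (by rwa [hHcard]) (by rwa [hHcard])
      (shortSums_zmod M (Nat.Coprime.mul_right hM2.symm hM3.symm)) ψ hψ hε k hu ?_
    rw [← hf.autocorrelation hu]
    refine sum_congr rfl fun x _ => ?_
    rw [hk, hk, map_mul, ← AddChar.map_neg_eq_conj, sub_eq_add_neg, AddChar.map_add_eq_mul]
    push_cast
    simp only [map_intCast]
    ring
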